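/- Setting. Let $d,\ell\in\mathbb{N}$ and let $\Omega\subseteq\mathbb{R}^d$ be a bounded open set with $\operatorname{int}(\overline{\Omega})=\Omega$ (for instance, a bounded polyhedral Lipschitz domain) whose closure is the union of a finite conforming triangulation $\mathcal{T}_h$ into nondegenerate closed $d$-simplices (two elements intersect in the simplex spanned by their common vertices). Inner sides are the common $(d-1)$-dimensional faces of two distinct elements; boundary sides are the $(d-1)$-dimensional faces of elements that are contained in $\partial\Omega$. Let $\partial\Omega=\Gamma_D\,\dot\cup\,\Gamma_N$ be resolved by $\mathcal{T}_h$, i.e., the relative interior of each boundary side is contained in $\Gamma_D$ or in $\Gamma_N$; $\mathcal{S}_h^{\Gamma_D}$ and $\mathcal{S}_h^{\Gamma_N}$ are the corresponding sets of boundary sides. Integrals over $\Gamma_D$, $\Gamma_N$ and conditions on them refer to these sides and to the $(d-1)$-dimensional surface measure. $\mathcal{L}^k(\mathcal{T}_h)$ is the space of element-wise polynomials of degree at most $k$; $\Pi_h$ and $\pi_h$ denote averaging over elements and over sides, respectively; $\nabla_h$ is the element-wise gradient, $\operatorname{div}$ the (element-wise) row-wise divergence, and $n_T$ the outward unit normal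 of $T\in\mathcal{T}_h$ (with $n=n_T$ on boundary sides of $T$). Let $U_\ell^{cr}$ be the space of all $v_h\in(\mathcal{L}^1(\mathcal{T}_h))^\ell$ whose jump $[\![v_h]\!]_S$ satisfies $\pi_h[\![v_h]\!]_S=0$ on each inner side $S$ (Crouzeix–Raviart), and $Z_\ell^{rt}$ the space of all $y_h\in(\mathcal{L}^1(\mathcal{T}_h))^{\ell\times d}$ such that $y_h|_T\,n_T$ is constant on each side of each $T\in\mathcal{T}_h$ and $y_h|_{T_+}n_{T_+}+y_h|_{T_-}n_{T_-}=0$ on each inner side $S=T_+\cap T_-$ (row-wise lowest-order Raviart–Thomas). Let $\phi_h\colon\Omega\times\mathbb{R}^{\ell\times d}\to\mathbb{R}\cup\{+\infty\}$ and $\psi_h\colon\Omega\times\mathbb{R}^{\ell}\to\mathbb{R}\cup\{+\infty\}$ be such that, for a.e. $x\in\Omega$, $\phi_h(x,\cdot)$ and $\psi_h(x,\cdot)$ are proper, convex and lower semicontinuous, and which are element-wise constant in $x$, i.e., on each $T\in\mathcal{T}_h$ the functions $\phi_h(x,\cdot)$ and $\psi_h(x,\cdot)$ do not depend on $x$, up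 to a null set of $x\in T$. Let $\phi_h^*,\psi_h^*$ be their Fenchel conjugates in the second argument. "$C^1$" below includes being finite everywhere. Let $g_h\in(\mathcal{L}^0(\mathcal{S}_h^{\Gamma_N}))^\ell$ and $u_D^h\in(\mathcal{L}^0(\mathcal{S}_h^{\Gamma_D}))^\ell$ be side-wise constant. For $v_h\in U_\ell^{cr}$ and $y_h\in Z_\ell^{rt}$ define $$I_h^{cr}(v_h)=\int_\Omega\phi_h(\cdot,\nabla_hv_h)\,dx+\int_\Omega\psi_h(\cdot,\Pi_hv_h)\,dx-\int_{\Gamma_N}g_h\cdot\pi_hv_h\,ds+\begin{cases}0&\text{if }\pi_hv_h=u_D^h\text{ on }\Gamma_D,\\+\infty&\text{else,}\end{cases}$$ $$D_h^{rt}(y_h)=-\int_\Omega\phi_h^*(\cdot,\Pi_hy_h)\,dx-\int_\Omega\psi_h^*(\cdot,\operatorname{div}y_h)\,dx+\int_{\Gamma_D}y_hn\cdot u_D^h\,ds-\begin{cases}0&\text{if }y_hn=g_h\text{ on }\Gamma_N,\\+\infty&\text{else.}\end{cases}$$ Proposition (Generalized Marini formulas). (i) If $\phi_h(x,\cdot)\in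 C^1(\mathbb{R}^{\ell\times d})$ and $\psi_h(x,\cdot)\in C^1(\mathbb{R}^{\ell})$ for a.e. $x\in\Omega$, then, for every minimizer $u_h^{cr}$ of $I_h^{cr}$ over $U_\ell^{cr}$, the formula $$z_h^{rt}=D\phi_h(\cdot,\nabla_hu_h^{cr})+\frac{D\psi_h(\cdot,\Pi_hu_h^{cr})}{d}\otimes(\mathrm{id}_{\mathbb{R}^d}-\Pi_h\mathrm{id}_{\mathbb{R}^d})\quad\text{a.e. in }\Omega$$ defines an element $z_h^{rt}\in Z_\ell^{rt}$, it is a maximizer of $D_h^{rt}$ over $Z_\ell^{rt}$, and $I_h^{cr}(u_h^{cr})=D_h^{rt}(z_h^{rt})$. (ii) If $\phi_h^*(x,\cdot)\in C^1(\mathbb{R}^{\ell\times d})$ and $\psi_h^*(x,\cdot)\in C^1(\mathbb{R}^{\ell})$ for a.e. $x\in\Omega$, then, for every maximizer $z_h^{rt}$ of $D_h^{rt}$ over $Z_\ell^{rt}$, the formula $$u_h^{cr}=D\psi_h^*(\cdot,\operatorname{div}z_h^{rt})+D\phi_h^*(\cdot,\Pi_hz_h^{rt})(\mathrm{id}_{\mathbb{R}^d}-\Pi_h\mathrm{id}_{\mathbb{R}^d})\quad\text{a.e.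 in }\Omega$$ defines an element $u_h^{cr}\in U_\ell^{cr}$, it is a minimizer of $I_h^{cr}$ over $U_\ell^{cr}$, and $I_h^{cr}(u_h^{cr})=D_h^{rt}(z_h^{rt})$. -/

import Mathlib

open MeasureTheory

noncomputable section

namespace DiscreteDuality

/-! ### Vectors and matrices -/

/-- The space `ℝ^n` with its Euclidean inner product. -/
abbrev Vec (n : ℕ) : Type := EuclideanSpace ℝ (Fin n)

/-- The space `ℝ^{ℓ × d}` of matrices with the Frobenius inner product. -/
abbrev Mat (l d : ℕ) : Type := EuclideanSpace ℝ (Fin l × Fin d)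

/-- Matrix-vector product. -/
def matVec {l d : ℕ} (A : Mat l d) (w : Vec d) : Vec l :=
  WithLp.toLp 2 fun i => ∑ j, A (i, j) * w j

/-- The outer product `b ⊗ w = (b_i w_j)_{ij}`. -/
def outer {l d : ℕ} (b : Vec l) (w : Vec d) : Mat l d :=
  WithLp.toLp 2 fun p => b p.1 * w p.2

/-! ### Convex analysis for extended-real-valued functions -/

section Convex

variable {F : Type*} [NormedAddCommGroup F] [InnerProductSpace ℝ F]

/-- `f : F → ℝ ∪ {+∞}`, not identically `+∞`. -/
def ProperFun (f : F → EReal) : Prop := (∀ r, f r ≠ ⊥) ∧ ∃ r, f r ≠ ⊤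

/-- Convexity of an extended-real-valued function: its epigraph is convex. -/
def ConvexFun (f : F → EReal) : Prop :=
  Convex ℝ {p : F × ℝ | f p.1 ≤ (p.2 : EReal)}

/-- The Fenchel conjugate (the dual of `F` being identified with `F` by the inner product). -/
def conj (f : F → EReal) (s : F) : EReal := ⨆ r : F, (((inner ℝ s r : ℝ) : EReal) - f r)

/-- `f` is finite everywhere and continuously differentiable. -/
def IsC1 (f : F → EReal) : Prop :=
  ∃ g : F → ℝ, ContDiff ℝ 1 g ∧ ∀ r, f r = (g r : EReal)

/-- The gradient `Df(r)` (meaningful where `f` is finite and differentiable, e.g. if `IsC1 f`). -/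
def D [CompleteSpace F] (f : F → EReal) (r : F) : F := gradient (fun q => (f q).toReal) r

end Convex

/-- The integral of an extended-real-valued function: integral of the positive part minus integral
of the negative part. -/
def eintegral {X : Type*} [MeasurableSpace X] (μ : Measure X) (f : X → EReal) : EReal :=
  ((∫⁻ x, (f x).toENNReal ∂μ : ENNReal) : EReal) - ((∫⁻ x, (-f x).toENNReal ∂μ : ENNReal) : EReal)

/-! ### Triangulations -/

/-- The (closed) simplex spanned by a finite set of points. -/
def simplex {d : ℕ} (T : Finset (Vec d)) : Set (Vec d) := convexHull ℝ (T : Set (Vec d))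

/-- A (finite, conforming) triangulation of `Ω ⊆ ℝ^d` into nondegenerate `d`-simplices; every simplex
is given by the set of its `d + 1` vertices. -/
structure Triangulation {d : ℕ} (Ω : Set (Vec d)) where
  elements : Finset (Finset (Vec d))
  card_eq : ∀ T ∈ elements, T.card = d + 1
  indep : ∀ T ∈ elements, AffineIndependent ℝ ((↑) : {x // x ∈ T} → Vec d)
  cover : closure Ω = ⋃ T ∈ elements, simplex T
  conforming : ∀ T ∈ elements, ∀ T' ∈ elements,
    simplex T ∩ simplex T' = convexHull ℝ ((T : Set (Vec d)) ∩ (T' : Set (Vec d)))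

/-- `n` is the outward unit normal of the simplex with vertices `T` on its side with vertices `S`. -/
def IsOuterNormal {d : ℕ} (T S : Finset (Vec d)) (n : Vec d) : Prop :=
  ‖n‖ = 1 ∧ (∀ x ∈ S, ∀ x' ∈ S, inner ℝ n (x - x') = 0) ∧
    ∀ x ∈ S, ∀ p ∈ T, p ∉ S → inner ℝ n (p - x) < 0

/-- The outward unit normal `n_T` of the simplex with vertices `T` on its side with vertices `S`. -/
def outerNormal {d : ℕ} (T S : Finset (Vec d)) : Vec d :=
  Classical.epsilon (IsOuterNormal T S)

namespace Triangulation

variable {d : ℕ} {Ω : Set (Vec d)} (Th : Triangulation Ω)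

/-- `S` is (the vertex set of) the common side of the distinct elements `T` and `T'`. -/
def IsInnerSide (T T' : Th.elements) (S : Finset (Vec d)) : Prop :=
  T ≠ T' ∧ S.card = d ∧ S ⊆ T.1 ∧ S ⊆ T'.1

/-- `S` is (the vertex set of) a boundary side: a side of an element that is contained in `∂Ω`. -/
def IsBoundarySide (S : Finset (Vec d)) : Prop :=
  S.card = d ∧ (∃ T ∈ Th.elements, S ⊆ T) ∧ simplex S ⊆ frontier Ω

/-- Boundary sides that belong to `γ ⊆ ∂Ω`, i.e. whose (relative) interior is contained in `γ`. -/
def IsSideOn (γ : Set (Vec d)) (S : Finset (Vec d)) : Prop :=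
  Th.IsBoundarySide S ∧ intrinsicInterior ℝ (simplex S) ⊆ γ

/-- `Γ_D` and `Γ_N` are a disjoint partition of `∂Ω` which is resolved by the triangulation. -/
def IsBoundaryPartition (ΓD ΓN : Set (Vec d)) : Prop :=
  Disjoint ΓD ΓN ∧ ΓD ∪ ΓN = frontier Ω ∧
    ∀ S, Th.IsBoundarySide S → Th.IsSideOn ΓD S ∨ Th.IsSideOn ΓN S

/-- Element-wise affine functions with values in `F`, given by one affine function per element. -/
abbrev Broken (F : Type*) [AddCommGroup F] [Module ℝ F] : Type _ :=
  Th.elements → (Vec d →ᵃ[ℝ] F)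

open Classical in
/-- The sum of `a T S` over all sides `S` belonging to `γ`, where `T` is the element with side `S`. -/
def sumSides (γ : Set (Vec d)) (a : Th.elements → Finset (Vec d) → ℝ) : ℝ :=
  ∑ T : Th.elements, ∑ S ∈ (T.1.powersetCard d).filter (Th.IsSideOn γ), a T S

/-- The average `Π_h v` over the element `T`. -/
def elemAvg {F : Type*} [NormedAddCommGroup F] [NormedSpace ℝ F]
    (T : Finset (Vec d)) (v : Vec d → F) : F :=
  ⨍ x in simplex T, v x

/-- The average `π_h v` over the side `S`, with respect to the surface measure. -/
def sideAvg {F : Type*} [NormedAddCommGroup F] [NormedSpace ℝ F]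
    (S : Finset (Vec d)) (v : Vec d → F) : F :=
  ⨍ x in simplex S, v x ∂(μHE[d - 1] : Measure (Vec d))

/-- The gradient `(∂_j v_i)_{ij}` of an affine function `v`. -/
def grad {l : ℕ} (v : Vec d →ᵃ[ℝ] Vec l) : Mat l d :=
  WithLp.toLp 2 fun p => v.linear (EuclideanSpace.single p.2 1) p.1

/-- The row-wise divergence `(∑_j ∂_j y_{ij})_i` of an affine matrix field `y`. -/
def div {l : ℕ} (y : Vec d →ᵃ[ℝ] Mat l d) : Vec l :=
  WithLp.toLp 2 fun i => ∑ j, y.linear (EuclideanSpace.single j 1) (i, j)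

/-- The Crouzeix--Raviart space `(S^{1,cr}(T_h))^ℓ`. -/
def CR (l : ℕ) : Set (Th.Broken (Vec l)) :=
  {v | ∀ T T' S, Th.IsInnerSide T T' S → sideAvg S (fun x => v T x - v T' x) = 0}

/-- The space of matrix fields all of whose rows are lowest-order Raviart--Thomas fields: on every
side of an element the normal component is constant, and on inner sides the normal jump vanishes. -/
def RT (l : ℕ) : Set (Th.Broken (Mat l d)) :=
  {y | (∀ T : Th.elements, ∀ S ∈ T.1.powersetCard d, ∀ x ∈ simplex S, ∀ x' ∈ simplex S,
      matVec (y T x) (outerNormal T.1 S) = matVec (y T x') (outerNormal T.1 S)) ∧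
    ∀ T T' S, Th.IsInnerSide T T' S → ∀ x ∈ simplex S,
      matVec (y T x) (outerNormal T.1 S) + matVec (y T' x) (outerNormal T'.1 S) = 0}

/-- Standing assumptions on an integrand `f : Ω × F → ℝ ∪ {+∞}`: for a.e. `x ∈ Ω` the function
`f(x,·)` is proper, convex and lower semicontinuous, and `f` is element-wise constant in `x`. -/
def IsIntegrand {F : Type*} [NormedAddCommGroup F] [InnerProductSpace ℝ F]
    (f : Vec d → F → EReal) : Prop :=
  (∀ᵐ x ∂(volume.restrict Ω), ProperFun (f x) ∧ ConvexFun (f x) ∧ LowerSemicontinuous (f x)) ∧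
    ∀ T ∈ Th.elements, ∃ c : F → EReal, ∀ᵐ x ∂(volume.restrict (simplex T)), ∀ r, f x r = c r

open Classical in
/-- The discrete primal energy functional `I_h^{cr}`. The data `gN` and `uD` are side-wise constant;
only the values of `gN` on sides on `Γ_N` and those of `uD` on sides on `Γ_D` enter. -/
def primal {l : ℕ} (ΓD ΓN : Set (Vec d)) (φ : Vec d → Mat l d → EReal) (ψ : Vec d → Vec l → EReal)
    (gN uD : Finset (Vec d) → Vec l) (v : Th.Broken (Vec l)) : EReal :=
  (∑ T : Th.elements, eintegral (volume.restrict (simplex T.1)) fun x => φ x (grad (v T)))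
    + (∑ T : Th.elements, eintegral (volume.restrict (simplex T.1)) fun x => ψ x (elemAvg T.1 (v T)))
    - ((Th.sumSides ΓN fun T S =>
        ∫ _x in simplex S, inner ℝ (gN S) (sideAvg S (v T)) ∂(μHE[d - 1] : Measure (Vec d)) : ℝ) :
          EReal)
    + (if ∀ T : Th.elements, ∀ S ⊆ T.1, Th.IsSideOn ΓD S → sideAvg S (v T) = uD S then 0 else ⊤)

open Classical in
/-- The discrete dual energy functional `D_h^{rt}`. -/
def dual {l : ℕ} (ΓD ΓN : Set (Vec d)) (φ : Vec d → Mat l d → EReal) (ψ : Vec d → Vec l → EReal)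
    (gN uD : Finset (Vec d) → Vec l) (y : Th.Broken (Mat l d)) : EReal :=
  - (∑ T : Th.elements,
      eintegral (volume.restrict (simplex T.1)) fun x => conj (φ x) (elemAvg T.1 (y T)))
    - (∑ T : Th.elements,
      eintegral (volume.restrict (simplex T.1)) fun x => conj (ψ x) (div (y T)))
    + ((Th.sumSides ΓD fun T S =>
        ∫ x in simplex S, inner ℝ (matVec (y T x) (outerNormal T.1 S)) (uD S)
          ∂(μHE[d - 1] : Measure (Vec d)) : ℝ) : EReal)
    - (if ∀ T : Th.elements, ∀ S ⊆ T.1, Th.IsSideOn ΓN S →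
          ∀ x ∈ simplex S, matVec (y T x) (outerNormal T.1 S) = gN S then 0 else ⊤)

end Triangulation

end DiscreteDuality

end

open MeasureTheory

noncomputable section

namespace DiscreteDuality

/-! ### Barycentric coordinates -/

/-! The core is a discrete integration by parts. For `v` Crouzeix--Raviart and `y` Raviart--Thomas,
the sum over the elements of `|T| (Π_h y : ∇v + div y · Π_h v)` equals the sum over the boundary
sides of `|S| (y n) · π_h v`: on an inner side `y n` is constant and changes sign between the
neighbours while the means of `v` agree, so these contributions cancel (`gauss_CR_RT`). Hence, for
admissible fields with finite energies, primal minus dual is a sum over the elements of `|T|` times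
two nonnegative Fenchel--Young gaps (`gap_eq`). This gives weak duality, and equality once all gaps
vanish.

In (i) the reconstructed field has mean `Dφ(∇u)` and divergence `Dψ(Π_h u)`, which makes every gap
vanish; only admissibility is in question. Its normal components are constant on sides by
construction, and this alone permits integration by parts on each element. Together with the
Euler--Lagrange equations of `u` it yields a weak identity involving only side contributions. Since
side means of Crouzeix--Raviart functions can be prescribed arbitrarily, testing with functions
concentrated on one side shows that the normal jumps vanish and that the Neumann condition holds
(`mem_RT_of_weak`). Part (ii) is the mirror image, with fields of prescribed normal components as
test fields (`mem_CR_of_weak`); there the gaps vanish by a Fenchel--Moreau argument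
(`apply_gradient_conj`).

The geometry is done in barycentric coordinates `λ_p`. Means of affine functions are means of vertex
values, and `|S| n_S · w = -d |T| ∂_w λ_p` for the side `S` opposite to `p`, by the volume of a
pyramid. Conformity and `int (closure Ω) = Ω` imply that a boundary side lies in one element and
every other side in exactly two. -/

/-- `T` is the vertex set of a nondegenerate `d`-simplex in `ℝ^d`. -/
structure Nondeg {d : ℕ} (T : Finset (Vec d)) : Prop where
  card_eq : T.card = d + 1
  indep : AffineIndependent ℝ ((↑) : {x // x ∈ T} → Vec d)

/-- The mean of the vertices of `S`. -/
theorem affine_mean {d : ℕ} {S : Finset (Vec d)} (hS : S.Nonempty)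
    {F : Type*} [AddCommGroup F] [Module ℝ F]
    (v : Vec d →ᵃ[ℝ] F) : v ((S.card : ℝ)⁻¹ • ∑ p ∈ S, p) = (S.card : ℝ)⁻¹ • ∑ p ∈ S, v p := by
  obtain ⟨c, h⟩ : ∃ c, ∀ p, v p = v.linear p + c :=
    ⟨v 0, fun p => by simpa using v.map_vadd 0 p⟩
  have hc : (S.card : ℝ) ≠ 0 := by simpa using hS.ne_empty
  simp only [h, Finset.sum_add_distrib, map_smul, map_sum, smul_add, Finset.sum_const]
  rw [← Nat.cast_smul_eq_nsmul ℝ, smul_smul, inv_mul_cancel₀ hc, one_smul]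

namespace Nondeg

variable {d : ℕ} {T : Finset (Vec d)} (hT : Nondeg T)
include hT

theorem affineSpan_eq_top : affineSpan ℝ (Set.range ((↑) : {x // x ∈ T} → Vec d)) = ⊤ := by
  rw [hT.indep.affineSpan_eq_top_iff_card_eq_finrank_add_one]
  simp [hT.card_eq]

/-- The vertices of a nondegenerate simplex as an affine basis. -/
def basis : AffineBasis {x // x ∈ T} ℝ (Vec d) := ⟨(↑), hT.indep, hT.affineSpan_eq_top⟩

omit hT in
open Classical in
/-- The barycentric coordinate of the vertex `p`, extended by `0` to points that are no vertices. -/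
def bary (hT : Nondeg T) (p : Vec d) : Vec d →ᵃ[ℝ] ℝ :=
  if h : p ∈ T then hT.basis.coord ⟨p, h⟩ else 0

theorem bary_of_mem {p : Vec d} (h : p ∈ T) : hT.bary p = hT.basis.coord ⟨p, h⟩ := by
  simp [bary, h]

theorem bary_self {p : Vec d} (h : p ∈ T) : hT.bary p p = 1 := by
  rw [hT.bary_of_mem h]
  exact hT.basis.coord_apply_eq ⟨p, h⟩

theorem bary_ne {p q : Vec d} (h : p ∈ T) (hq : q ∈ T) (hpq : p ≠ q) : hT.bary p q = 0 := by
  rw [hT.bary_of_mem h]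
  exact hT.basis.coord_apply_ne (i := ⟨p, h⟩) (j := ⟨q, hq⟩) (by simpa using hpq)

theorem sum_eq_sum_subtype {M : Type*} [AddCommMonoid M] (f : (Vec d →ᵃ[ℝ] ℝ) → Vec d → M) :
    ∑ p ∈ T, f (hT.bary p) p = ∑ i : {x // x ∈ T}, f (hT.basis.coord i) i := by
  rw [← Finset.sum_coe_sort]
  refine Finset.sum_congr rfl fun i _ => ?_
  rw [hT.bary_of_mem i.2]

theorem sum_bary (x : Vec d) : ∑ p ∈ T, hT.bary p x = 1 := by
  rw [hT.sum_eq_sum_subtype (fun c _ => c x)]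
  exact hT.basis.sum_coord_apply_eq_one x

theorem sum_bary_smul (x : Vec d) : ∑ p ∈ T, hT.bary p x • p = x := by
  rw [hT.sum_eq_sum_subtype (fun c p => c x • p)]
  exact hT.basis.linear_combination_coord_eq_self x

/-- Derivative of the identity that the coordinates sum to `1`. -/
theorem sum_bary_linear (w : Vec d) : ∑ p ∈ T, (hT.bary p).linear w = 0 := by
  have h := hT.sum_bary (w + 0)
  have h0 := hT.sum_bary 0
  have : ∀ p, hT.bary p (w + 0) = (hT.bary p).linear w + hT.bary p 0 := fun p =>
    (hT.bary p).map_vadd 0 w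
  simp only [this, Finset.sum_add_distrib, h0] at h
  linarith

theorem sum_bary_linear_smul (w : Vec d) : ∑ p ∈ T, (hT.bary p).linear w • p = w := by
  have h := hT.sum_bary_smul (w + 0)
  have h0 := hT.sum_bary_smul 0
  have : ∀ p, hT.bary p (w + 0) = (hT.bary p).linear w + hT.bary p 0 := fun p =>
    (hT.bary p).map_vadd 0 w
  simp only [this, add_smul, Finset.sum_add_distrib, h0] at h
  simpa using h

variable {F : Type*} [AddCommGroup F] [Module ℝ F]

theorem affine_linear_eq_sum (v : Vec d →ᵃ[ℝ] F) (w : Vec d) :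
    v.linear w = ∑ p ∈ T, (hT.bary p).linear w • v p := by
  obtain ⟨c, h⟩ : ∃ c, ∀ p, v p = v.linear p + c :=
    ⟨v 0, fun p => by simpa using v.map_vadd 0 p⟩
  simp only [h, smul_add, Finset.sum_add_distrib, ← Finset.sum_smul, hT.sum_bary_linear, zero_smul,
    add_zero]
  conv_lhs => rw [← hT.sum_bary_linear_smul w]
  simp

theorem affine_eq_sum (v : Vec d →ᵃ[ℝ] F) (x : Vec d) :
    v x = ∑ p ∈ T, hT.bary p x • v p := by
  obtain ⟨c, h⟩ : ∃ c, ∀ p, v p = v.linear p + c :=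
    ⟨v 0, fun p => by simpa using v.map_vadd 0 p⟩
  simp only [h, smul_add, Finset.sum_add_distrib, ← Finset.sum_smul, hT.sum_bary, one_smul]
  conv_lhs => rw [← hT.sum_bary_smul x]
  simp

theorem continuous_bary (p : Vec d) : Continuous (hT.bary p) :=
  (hT.bary p).continuous_of_finiteDimensional

theorem mem_simplex {x : Vec d} : x ∈ simplex T ↔ ∀ p ∈ T, 0 ≤ hT.bary p x := by
  have h := hT.basis.convexHull_eq_nonneg_coord
  have hr : Set.range hT.basis = (T : Set (Vec d)) := by
    exact Subtype.range_coe
  rw [hr] at h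
  rw [simplex, h]
  constructor
  · intro hx p hp
    rw [hT.bary_of_mem hp]
    exact hx _
  · intro hx i
    have := hx i i.2
    rwa [hT.bary_of_mem i.2] at this

/-- The set described by the coordinates is convex and contains the vertices of `S`; conversely, the
remaining coordinates are the weights of a convex combination of `S`. Through this, conformity
becomes usable: a point of two elements has zero coordinate at every vertex they do not share. -/
theorem mem_simplex_of_subset {S : Finset (Vec d)} (hS : S ⊆ T) {x : Vec d} :
    x ∈ simplex S ↔ (∀ p ∈ S, 0 ≤ hT.bary p x) ∧ ∀ p ∈ T, p ∉ S → hT.bary p x = 0 := by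
  classical
  constructor
  · intro hx
    have hconv : Convex ℝ {x : Vec d | (∀ p ∈ S, 0 ≤ hT.bary p x) ∧
        ∀ p ∈ T, p ∉ S → hT.bary p x = 0} := by
      intro x hx y hy a b ha hb hab
      have key : ∀ p, hT.bary p (a • x + b • y) = a * hT.bary p x + b * hT.bary p y := by
        intro p
        have := Convex.combo_affine_apply (f := hT.bary p) (x := x) (y := y) hab
        simpa using this
      refine ⟨fun p hp => ?_, fun p hp hpS => ?_⟩
      · rw [key]
        have := hx.1 p hp
        have := hy.1 p hp
        positivity
      · rw [key, hx.2 p hp hpS, hy.2 p hp hpS]; simp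
    refine convexHull_min ?_ hconv hx
    intro q hq
    have hq' : q ∈ S := hq
    refine ⟨fun p hp => ?_, fun p hp hpS => ?_⟩
    · by_cases hpq : p = q
      · subst hpq; rw [hT.bary_self (hS hp)]; exact zero_le_one
      · rw [hT.bary_ne (hS hp) (hS hq') hpq]
    · exact hT.bary_ne hp (hS hq') (fun h => hpS (h ▸ hq'))
  · rintro ⟨h1, h2⟩
    have e1 : ∑ p ∈ S, hT.bary p x = 1 := by
      rw [← hT.sum_bary x]
      exact Finset.sum_subset hS h2
    have e2 : ∑ p ∈ S, hT.bary p x • p = x := by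
      conv_rhs => rw [← hT.sum_bary_smul x]
      exact Finset.sum_subset hS fun p hp hpS => by rw [h2 p hp hpS, zero_smul]
    rw [← e2]
    exact (convex_convexHull ℝ _).sum_mem h1 e1 fun p hp => subset_convexHull ℝ _ hp

end Nondeg

/-! ### Measures of simplices and averages of affine functions -/

theorem isCompact_simplex {d : ℕ} (T : Finset (Vec d)) : IsCompact (simplex T) :=
  T.finite_toSet.isCompact_convexHull ℝ

theorem convex_simplex {d : ℕ} (T : Finset (Vec d)) : Convex ℝ (simplex T) := convex_convexHull ℝ _

theorem measurableSet_simplex {d : ℕ} (T : Finset (Vec d)) : MeasurableSet (simplex T) :=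
  (isCompact_simplex T).measurableSet

namespace Nondeg

variable {d : ℕ} {T : Finset (Vec d)} (hT : Nondeg T)
include hT

theorem interior_nonempty : (interior (simplex T)).Nonempty := by
  rw [simplex, interior_convexHull_nonempty_iff_affineSpan_eq_top, ← hT.affineSpan_eq_top]
  congr 1
  exact Subtype.range_coe.symm

theorem volume_ne_zero : volume (simplex T) ≠ 0 := by
  have := isOpen_interior.measure_pos volume hT.interior_nonempty
  exact (this.trans_le (measure_mono interior_subset)).ne'

omit hT in
theorem volume_ne_top : volume (simplex T) ≠ ⊤ := (isCompact_simplex T).measure_lt_top.ne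

theorem volume_real_pos : 0 < volume.real (simplex T) :=
  ENNReal.toReal_pos hT.volume_ne_zero volume_ne_top

/-- The affine map exchanging the vertices `p` and `q` and fixing all others is `x ↦ x + (λ_p x -
λ_q x) (q - p)`. It preserves volume and the simplex, so it shows that all barycentric coordinates
have the same integral. -/
theorem exists_swap {p q : Vec d} (hp : p ∈ T) (hq : q ∈ T) (hpq : p ≠ q) :
    ∃ σ : Vec d → Vec d, MeasurePreserving σ ∧ MeasurableEmbedding σ ∧
      σ ⁻¹' simplex T = simplex T ∧ ∀ x, hT.bary p (σ x) = hT.bary q x := by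
  let f : Vec d →ₗ[ℝ] ℝ := (hT.bary p).linear - (hT.bary q).linear
  let L : Vec d →ₗ[ℝ] Vec d := LinearMap.id + f.smulRight (q - p)
  let c : ℝ := hT.bary p 0 - hT.bary q 0
  have lin : ∀ r a b, (hT.bary r).linear (a - b) = hT.bary r a - hT.bary r b := fun r a b => by
    simpa using (hT.bary r).linearMap_vsub a b
  have hL : ∀ w, L w = w + f w • (q - p) := fun w => rfl
  have hf : f (q - p) = -2 := by
    simp only [f, LinearMap.sub_apply, lin, hT.bary_self hp, hT.bary_self hq, hT.bary_ne hp hq hpq,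
      hT.bary_ne hq hp hpq.symm]
    norm_num
  -- Because `f (q - p) = -2`, the linear part is an involution, so its determinant is `±1`.
  have hLL : L ∘ₗ L = LinearMap.id := by
    ext1 w
    simp only [LinearMap.comp_apply, hL, LinearMap.id_apply, map_add, map_smul, hf]
    module
  have hdet : LinearMap.det L * LinearMap.det L = 1 := by
    rw [← LinearMap.det_comp, hLL, LinearMap.det_id]
  have habs : |LinearMap.det L| = 1 := by
    rw [← Real.sqrt_mul_self_eq_abs, hdet, Real.sqrt_one]
  have hLc : Continuous L := L.continuous_of_finiteDimensional
  have hLm : MeasurePreserving L := by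
    refine ⟨hLc.measurable, ?_⟩
    rw [Measure.map_linearMap_addHaar_eq_smul_addHaar volume (f := L)
      (by intro h; rw [h] at habs; simp at habs), abs_inv, habs]
    simp
  have hLh : ∀ w, L (L w) = w := fun w => LinearMap.congr_fun hLL w
  let σ : Vec d → Vec d := fun x => L x + c • (q - p)
  have hσ : ∀ x, σ x = x + (hT.bary p x - hT.bary q x) • (q - p) := by
    intro x
    have e : ∀ r, hT.bary r x = (hT.bary r).linear x + hT.bary r 0 := fun r => by
      simpa using (hT.bary r).map_vadd 0 x
    simp only [σ, hL, f, c, LinearMap.sub_apply, e p, e q]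
    module
  have hb : ∀ r ∈ T, ∀ x, hT.bary r (σ x) = hT.bary r x
      + (hT.bary p x - hT.bary q x) * (hT.bary r q - hT.bary r p) := by
    intro r hr x
    rw [hσ, add_comm x]
    have := (hT.bary r).map_vadd x ((hT.bary p x - hT.bary q x) • (q - p))
    simp only [vadd_eq_add, map_smul, lin, smul_eq_mul] at this
    linarith
  have hbp : ∀ x, hT.bary p (σ x) = hT.bary q x := fun x => by
    rw [hb p hp, hT.bary_self hp, hT.bary_ne hp hq hpq]; ring
  have hbq : ∀ x, hT.bary q (σ x) = hT.bary p x := fun x => by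
    rw [hb q hq, hT.bary_self hq, hT.bary_ne hq hp hpq.symm]; ring
  have hbr : ∀ r ∈ T, r ≠ p → r ≠ q → ∀ x, hT.bary r (σ x) = hT.bary r x := fun r hr h1 h2 x => by
    rw [hb r hr, hT.bary_ne hr hp h1, hT.bary_ne hr hq h2]; ring
  refine ⟨σ, ?_, ?_, ?_, hbp⟩
  · exact (measurePreserving_add_right volume (c • (q - p))).comp hLm
  · refine (measurableEmbedding_addRight (c • (q - p))).comp ?_
    exact (Homeomorph.mk ⟨L, L, hLh, hLh⟩ hLc hLc).measurableEmbedding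
  · ext x
    rw [Set.mem_preimage, hT.mem_simplex, hT.mem_simplex]
    constructor
    · intro h r hr
      by_cases h1 : r = p
      · rw [h1, ← hbq]; exact h q hq
      by_cases h2 : r = q
      · rw [h2, ← hbp]; exact h p hp
      rw [← hbr r hr h1 h2]; exact h r hr
    · intro h r hr
      by_cases h1 : r = p
      · rw [h1, hbp]; exact h q hq
      by_cases h2 : r = q
      · rw [h2, hbq]; exact h p hp
      rw [hbr r hr h1 h2]; exact h r hr

theorem setIntegral_bary_eq {p q : Vec d} (hp : p ∈ T) (hq : q ∈ T) :
    ∫ x in simplex T, hT.bary p x = ∫ x in simplex T, hT.bary q x := by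
  by_cases hpq : p = q
  · rw [hpq]
  obtain ⟨σ, h1, h2, h3, h4⟩ := hT.exists_swap hp hq hpq
  have := h1.setIntegral_preimage_emb h2 (hT.bary p) (simplex T)
  rw [h3] at this
  rw [← this]
  exact setIntegral_congr_fun (measurableSet_simplex T) fun x _ => h4 x

theorem integrableOn_bary (p : Vec d) : IntegrableOn (hT.bary p) (simplex T) :=
  (hT.continuous_bary p).continuousOn.integrableOn_compact (isCompact_simplex T)

/-- The `d + 1` coordinates have equal integrals, which sum to the volume. -/
theorem setIntegral_bary {p : Vec d} (hp : p ∈ T) :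
    ∫ x in simplex T, hT.bary p x = ((d : ℝ) + 1)⁻¹ * volume.real (simplex T) := by
  have h : ∑ q ∈ T, ∫ x in simplex T, hT.bary q x = volume.real (simplex T) := by
    rw [← integral_finsetSum _ fun q _ => hT.integrableOn_bary q]
    simp [hT.sum_bary]
  rw [Finset.sum_congr rfl fun q hq => hT.setIntegral_bary_eq hq hp, Finset.sum_const, hT.card_eq,
    nsmul_eq_mul] at h
  push_cast at h
  rw [← h]
  field_simp

variable {F : Type*} [NormedAddCommGroup F] [NormedSpace ℝ F]

theorem setAverage_affine [CompleteSpace F] (v : Vec d →ᵃ[ℝ] F) :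
    ⨍ x in simplex T, v x = ((d : ℝ) + 1)⁻¹ • ∑ p ∈ T, v p := by
  have h : ∫ x in simplex T, v x = (((d : ℝ) + 1)⁻¹ * volume.real (simplex T)) • ∑ p ∈ T, v p := by
    have e : ∀ x, v x = ∑ p ∈ T, hT.bary p x • v p := hT.affine_eq_sum v
    rw [integral_congr_ae (Filter.Eventually.of_forall e),
      integral_finsetSum _ fun q _ => (hT.integrableOn_bary q).smul_const _, Finset.smul_sum]
    exact Finset.sum_congr rfl fun q hq => by rw [integral_smul_const, hT.setIntegral_bary hq]
  rw [setAverage_eq, h, smul_smul]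
  congr 1
  have := hT.volume_real_pos.ne'
  field_simp

end Nondeg

/-- An affinely independent set of `k + 1` points is, up to an isometric embedding of `ℝ^k`, the
vertex set of a nondegenerate `k`-simplex. -/
theorem exists_isometry_nondeg {d k : ℕ} {S : Finset (Vec d)} (hc : S.card = k + 1)
    (hS : AffineIndependent ℝ ((↑) : {x // x ∈ S} → Vec d)) :
    ∃ (ι : Vec k →ᵃⁱ[ℝ] Vec d) (S' : Finset (Vec k)), Nondeg S' ∧
      S'.image ι = S := by
  classical
  have hne : S.Nonempty := by rw [← Finset.card_pos]; omega
  obtain ⟨a, ha⟩ := hne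
  -- The direction space of the affine span of `S` has dimension `k`; an orthonormal basis of it,
  -- followed by translation to `a ∈ S`, is the required isometry.
  let W := vectorSpan ℝ (Set.range ((↑) : {x // x ∈ S} → Vec d))
  have hW : Module.finrank ℝ W = k := by
    apply hS.finrank_vectorSpan
    simp [hc]
  let e : Vec k ≃ₗᵢ[ℝ] W :=
    ((stdOrthonormalBasis ℝ W).reindex (finCongr hW)).repr.symm
  let L : Vec k →ₗᵢ[ℝ] Vec d := W.subtypeₗᵢ.comp e.toLinearIsometry
  let ι : Vec k →ᵃⁱ[ℝ] Vec d :=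
    (AffineIsometryEquiv.vaddConst ℝ a).toAffineIsometry.comp L.toAffineIsometry
  have hι : ∀ x, ι x = (e x : Vec d) + a := fun x => rfl
  have hmem : ∀ p ∈ S, ∃ x, ι x = p := by
    intro p hp
    have : p - a ∈ W := by
      have := vsub_mem_vectorSpan ℝ (s := Set.range ((↑) : {x // x ∈ S} → Vec d))
        (p₁ := p) (p₂ := a) ⟨⟨p, hp⟩, rfl⟩ ⟨⟨a, ha⟩, rfl⟩
      exact this
    refine ⟨e.symm ⟨p - a, this⟩, ?_⟩
    rw [hι]; simp
  have himg : (S.preimage ι ι.injective.injOn).image ι = S := by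
    ext p
    simp only [Finset.mem_image, Finset.mem_preimage]
    constructor
    · rintro ⟨x, hx, rfl⟩; exact hx
    · intro hp
      obtain ⟨x, rfl⟩ := hmem p hp
      exact ⟨x, hp, rfl⟩
  refine ⟨ι, S.preimage ι ι.injective.injOn, ⟨?_, ?_⟩, himg⟩
  · rw [← hc]
    conv_rhs => rw [← himg]
    rw [Finset.card_image_of_injective _ ι.injective]
  · apply AffineIndependent.of_comp ι.toAffineMap
    let g : {x // x ∈ S.preimage ι ι.injective.injOn} ↪ {x // x ∈ S} :=
      ⟨fun x => ⟨ι x, by have := x.2; rwa [Finset.mem_preimage] at this⟩, fun x y h => by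
        have := congrArg Subtype.val h
        exact Subtype.ext (ι.injective this)⟩
    exact hS.comp_embedding g

theorem simplex_image {d k : ℕ} (ι : Vec k →ᵃⁱ[ℝ] Vec d) (S : Finset (Vec k)) :
    simplex (S.image ι) = ι '' simplex S := by
  classical
  rw [simplex, simplex, Finset.coe_image]
  exact (ι.toAffineMap.image_convexHull _).symm

theorem hausdorff_simplex_image {d k : ℕ} (ι : Vec k →ᵃⁱ[ℝ] Vec d) (S : Finset (Vec k)) :
    (μHE[k] : Measure (Vec d)) (simplex (S.image ι)) = volume (simplex S) := by
  rw [simplex_image, ι.isometry.euclideanHausdorffMeasure_image,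
    EuclideanSpace.euclideanHausdorffMeasure_eq_volume]

/-- On the range of the isometry, `k`-dimensional Hausdorff measure is the push-forward of Lebesgue
measure. Facts about volume averages on full-dimensional simplices thereby transfer to sides. -/
theorem setIntegral_simplex_image {d k : ℕ} (ι : Vec k →ᵃⁱ[ℝ] Vec d) (S : Finset (Vec k))
    {F : Type*} [NormedAddCommGroup F] [NormedSpace ℝ F] (v : Vec d → F) :
    ∫ x in simplex (S.image ι), v x ∂(μHE[k] : Measure (Vec d)) = ∫ x in simplex S, v (ι x) := by
  have hemb : MeasurableEmbedding ι := ι.isometry.isClosedEmbedding.measurableEmbedding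
  have hsub : simplex (S.image ι) ⊆ Set.range ι := by
    rw [simplex_image]; exact Set.image_subset_range _ _
  have h1 : (μHE[k] : Measure (Vec d)).restrict (simplex (S.image ι))
      = (Measure.map ι (volume : Measure (Vec k))).restrict (simplex (S.image ι)) := by
    rw [← EuclideanSpace.euclideanHausdorffMeasure_eq_volume,
      ι.isometry.map_euclideanHausdorffMeasure, Measure.restrict_restrict
      (measurableSet_simplex _), Set.inter_eq_left.2 hsub]
  rw [h1, hemb.setIntegral_map, simplex_image, Set.preimage_image_eq _ ι.injective]

/-- The mean value of an affine function over a simplex is the mean of its values in the vertices. -/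
theorem hausdorff_setAverage_affine {d k : ℕ} {S : Finset (Vec d)} (hc : S.card = k + 1)
    (hS : AffineIndependent ℝ ((↑) : {x // x ∈ S} → Vec d))
    {F : Type*} [NormedAddCommGroup F] [NormedSpace ℝ F] [CompleteSpace F] (v : Vec d →ᵃ[ℝ] F) :
    ⨍ x in simplex S, v x ∂(μHE[k] : Measure (Vec d)) = ((k : ℝ) + 1)⁻¹ • ∑ p ∈ S, v p := by
  classical
  obtain ⟨ι, S', hS', rfl⟩ := exists_isometry_nondeg hc hS
  rw [setAverage_eq, setIntegral_simplex_image, Measure.real, hausdorff_simplex_image,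
    ← Measure.real, ← setAverage_eq]
  rw [Finset.sum_image ι.injective.injOn]
  exact hS'.setAverage_affine (v.comp ι.toAffineMap)

theorem hausdorff_simplex_real_pos {d k : ℕ} {S : Finset (Vec d)} (hc : S.card = k + 1)
    (hS : AffineIndependent ℝ ((↑) : {x // x ∈ S} → Vec d)) :
    0 < (μHE[k] : Measure (Vec d)).real (simplex S) := by
  classical
  obtain ⟨ι, S', hS', rfl⟩ := exists_isometry_nondeg hc hS
  rw [Measure.real, hausdorff_simplex_image]
  exact hS'.volume_real_pos

/-! ### Outer normals and the volume of a pyramid -/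

theorem affine_sub {d : ℕ} {F : Type*} [AddCommGroup F] [Module ℝ F] (v : Vec d →ᵃ[ℝ] F)
    (a b : Vec d) : v.linear (a - b) = v a - v b := by
  simpa using v.linearMap_vsub a b

namespace Nondeg

variable {d : ℕ} {T : Finset (Vec d)} (hT : Nondeg T)
include hT

theorem card_erase {p : Vec d} (hp : p ∈ T) : (T.erase p).card = d := by
  rw [Finset.card_erase_of_mem hp, hT.card_eq]; rfl

theorem erase_nonempty (hd : 0 < d) {p : Vec d} (hp : p ∈ T) : (T.erase p).Nonempty := by
  rw [← Finset.card_pos, hT.card_erase hp]; exact hd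

theorem indep_of_subset {S : Finset (Vec d)} (hS : S ⊆ T) :
    AffineIndependent ℝ ((↑) : {x // x ∈ S} → Vec d) :=
  hT.indep.comp_embedding (Function.Embedding.subtypeMap (.refl _) hS)

/-- The normal is the normalised negative gradient of `λ_p`. Existence is what gives the choice in
`outerNormal` its meaning. -/
theorem exists_isOuterNormal (hd : 0 < d) {p : Vec d} (hp : p ∈ T) :
    ∃ n, IsOuterNormal T (T.erase p) n := by
  obtain ⟨x₀, hx₀⟩ := hT.erase_nonempty hd hp
  let f : Vec d →L[ℝ] ℝ := LinearMap.toContinuousLinearMap (hT.bary p).linear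
  let g : Vec d := (InnerProductSpace.toDual ℝ (Vec d)).symm f
  have hg : ∀ w, inner ℝ g w = (hT.bary p).linear w := fun w => by
    simp [g, f]
  have h0 : ∀ x ∈ T.erase p, hT.bary p x = 0 := fun x hx =>
    hT.bary_ne hp (Finset.mem_of_mem_erase hx) (Finset.ne_of_mem_erase hx).symm
  have hg0 : g ≠ 0 := by
    intro h
    have := hg (p - x₀)
    rw [h, inner_zero_left, affine_sub, hT.bary_self hp, h0 x₀ hx₀] at this
    norm_num at this
  have hgn : 0 < ‖g‖ := norm_pos_iff.2 hg0
  refine ⟨(-‖g‖⁻¹) • g, ?_, ?_, ?_⟩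
  · rw [norm_smul, norm_neg, norm_inv, norm_norm, inv_mul_cancel₀ hgn.ne']
  · intro x hx x' hx'
    rw [real_inner_smul_left, hg, affine_sub, h0 x hx, h0 x' hx']
    simp
  · intro x hx q hq hqS
    have : q = p := by
      by_contra h
      exact hqS (Finset.mem_erase.2 ⟨h, hq⟩)
    subst this
    rw [real_inner_smul_left, hg, affine_sub, h0 x hx, hT.bary_self hp]
    have : 0 < ‖g‖⁻¹ := inv_pos.2 hgn
    linarith

theorem isOuterNormal_outerNormal (hd : 0 < d) {p : Vec d} (hp : p ∈ T) :
    IsOuterNormal T (T.erase p) (outerNormal T (T.erase p)) :=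
  Classical.epsilon_spec (hT.exists_isOuterNormal hd hp)

theorem exists_height (hd : 0 < d) {p : Vec d} (hp : p ∈ T) :
    ∃ h : ℝ, 0 < h ∧ ∀ w, inner ℝ (outerNormal T (T.erase p)) w = -h * (hT.bary p).linear w := by
  obtain ⟨x₀, hx₀⟩ := hT.erase_nonempty hd hp
  obtain ⟨-, h1, h2⟩ := hT.isOuterNormal_outerNormal hd hp
  set n := outerNormal T (T.erase p)
  refine ⟨-inner ℝ n (p - x₀), ?_, fun w => ?_⟩
  · have := h2 x₀ hx₀ p hp (Finset.notMem_erase p T)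
    linarith
  -- The derivatives of the coordinates sum to zero, so a base point `x₀` on the side may be
  -- subtracted; then the normal annihilates every term except that of `p`.
  · have e : w = ∑ q ∈ T, (hT.bary q).linear w • (q - x₀) := by
      simp only [smul_sub, Finset.sum_sub_distrib, hT.sum_bary_linear_smul, ← Finset.sum_smul,
        hT.sum_bary_linear, zero_smul, sub_zero]
    conv_lhs => rw [e]
    rw [inner_sum, Finset.sum_eq_single_of_mem p hp]
    · rw [real_inner_smul_right]; ring
    · intro q hq hqp
      rw [real_inner_smul_right, h1 q (Finset.mem_erase.2 ⟨hqp, hq⟩) x₀ hx₀, mul_zero]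

/-- The distance of the vertex `p` to the opposite side. -/
def height (hT : Nondeg T) (hd : 0 < d) {p : Vec d} (hp : p ∈ T) : ℝ :=
  (hT.exists_height hd hp).choose

theorem height_pos (hd : 0 < d) {p : Vec d} (hp : p ∈ T) : 0 < hT.height hd hp :=
  (hT.exists_height hd hp).choose_spec.1

theorem inner_outerNormal (hd : 0 < d) {p : Vec d} (hp : p ∈ T) (w : Vec d) :
    inner ℝ (outerNormal T (T.erase p)) w = -hT.height hd hp * (hT.bary p).linear w :=
  (hT.exists_height hd hp).choose_spec.2 w

theorem mem_simplex_erase {p : Vec d} (hp : p ∈ T) {x : Vec d} :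
    x ∈ simplex (T.erase p) ↔ (∀ q ∈ T, q ≠ p → 0 ≤ hT.bary q x) ∧ hT.bary p x = 0 := by
  rw [hT.mem_simplex_of_subset (Finset.erase_subset p T)]
  constructor
  · rintro ⟨h1, h2⟩
    exact ⟨fun q hq hqp => h1 q (Finset.mem_erase.2 ⟨hqp, hq⟩), h2 p hp (Finset.notMem_erase p T)⟩
  · rintro ⟨h1, h2⟩
    refine ⟨fun q hq => h1 q (Finset.mem_of_mem_erase hq) (Finset.ne_of_mem_erase hq),
      fun q hq hqS => ?_⟩
    have : q = p := by
      by_contra h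
      exact hqS (Finset.mem_erase.2 ⟨h, hq⟩)
    rw [this, h2]

theorem bary_homothety (p q z : Vec d) (c : ℝ) :
    hT.bary q (AffineMap.homothety p c z) = c * hT.bary q z + (1 - c) * hT.bary q p := by
  rw [AffineMap.homothety_apply, vsub_eq_sub, (hT.bary q).map_vadd, map_smul, affine_sub]
  simp only [smul_eq_mul, vadd_eq_add]; ring

/-- The homothety with centre `p` multiplies all coordinates other than that of `p` by its ratio;
the homothety of inverse ratio gives the other inclusion. -/
theorem slice_eq_homothety {p : Vec d} (hp : p ∈ T) {c : ℝ} (hc : 0 < c) (hc1 : c ≤ 1) :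
    {y ∈ simplex T | 1 - hT.bary p y = c} = AffineMap.homothety p c '' simplex (T.erase p) := by
  ext y
  simp only [Set.mem_ofPred_eq, Set.mem_image, hT.mem_simplex, hT.mem_simplex_erase hp]
  constructor
  · rintro ⟨h1, h2⟩
    refine ⟨AffineMap.homothety p c⁻¹ y, ⟨fun q hq hqp => ?_, ?_⟩, ?_⟩
    · rw [hT.bary_homothety, hT.bary_ne hq hp hqp, mul_zero, add_zero]
      exact mul_nonneg (inv_pos.2 hc).le (h1 q hq)
    · rw [hT.bary_homothety, hT.bary_self hp, show hT.bary p y = 1 - c by linarith]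
      field_simp; ring
    · rw [← AffineMap.homothety_mul_apply, mul_inv_cancel₀ hc.ne', AffineMap.homothety_one]; rfl
  · rintro ⟨z, ⟨h1, h2⟩, rfl⟩
    refine ⟨fun q hq => ?_, ?_⟩
    · rw [hT.bary_homothety]
      by_cases hqp : q = p
      · subst hqp; rw [h2, hT.bary_self hp]; linarith
      · rw [hT.bary_ne hq hp hqp]
        have := h1 q hq hqp
        positivity
    · rw [hT.bary_homothety, h2, hT.bary_self hp]; ring

omit hT in
theorem lintegral_pyramid {h : ℝ} (hh : 0 < h) (m : ℕ) :
    ∫⁻ x in Set.Ioc 0 h, ENNReal.ofReal ((x / h) ^ m) = ENNReal.ofReal (h / (m + 1)) := by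
  rw [← ofReal_integral_eq_lintegral_ofReal, ← intervalIntegral.integral_of_le hh.le]
  · congr 1
    simp only [div_pow]
    rw [intervalIntegral.integral_div, integral_pow]
    have := hh.ne'
    field_simp
    simp [pow_succ]
  · have : Continuous fun x : ℝ => (x / h) ^ m := by fun_prop
    exact this.integrableOn_Ioc
  · filter_upwards [ae_restrict_mem measurableSet_Ioc] with x hx
    have := hx.1
    positivity

/-- Slice by hyperplanes orthogonal to the normal. At distance `x ∈ (0, h]` from the apex `p` the
slice is the opposite side scaled by `x / h`, so its area is scaled by `(x / h) ^ (d - 1)`, which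
integrates to `h / d`. -/
theorem measure_pyramid (hd : 0 < d) {p : Vec d} (hp : p ∈ T) :
    volume (simplex T) = ENNReal.ofReal (hT.height hd hp / d) *
      (μHE[d - 1] : Measure (Vec d)) (simplex (T.erase p)) := by
  set n := outerNormal T (T.erase p) with hn
  set h := hT.height hd hp with hh
  have hh0 : 0 < h := hT.height_pos hd hp
  have hn1 : ‖n‖ = 1 := (hT.isOuterNormal_outerNormal hd hp).1
  have hn0 : n ≠ 0 := by intro h0; rw [h0] at hn1; simp at hn1
  have key := EuclideanGeometry.euclideanHausdorffMeasure_eq_lintegral p hn0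
    (measurableSet_simplex T)
  have hfin : Module.finrank ℝ (Vec d) = d := by simp
  rw [InnerProductSpace.euclideanHausdorffMeasure_eq_volume, hfin] at key
  rw [key]
  have hn1' : ‖n‖ₑ = 1 := by rw [← ofReal_norm, hn1, ENNReal.ofReal_one]
  rw [hn1', one_mul]
  have hslice : ∀ x : ℝ, simplex T ∩ (AffineSubspace.mk' (x • n +ᵥ p) (Submodule.span ℝ {n})ᗮ :
      Set (Vec d)) = {y ∈ simplex T | 1 - hT.bary p y = x / h} := by
    intro x
    ext y
    simp only [Set.mem_inter_iff, SetLike.mem_coe, AffineSubspace.mem_mk', Set.mem_ofPred_eq,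
      Submodule.mem_orthogonal_singleton_iff_inner_right]
    refine and_congr_right fun _ => ?_
    have e1 : inner ℝ n (y -ᵥ (x • n +ᵥ p)) = h * (1 - hT.bary p y) - x := by
      have : y -ᵥ (x • n +ᵥ p) = (y - p) - x • n := by
        simp only [vsub_eq_sub, vadd_eq_add]; abel
      rw [this, inner_sub_right, hT.inner_outerNormal hd hp, affine_sub, hT.bary_self hp,
        real_inner_smul_right, real_inner_self_eq_norm_sq, hn1]
      ring
    rw [e1, eq_div_iff hh0.ne']
    constructor <;> intro h' <;> linarith
  have hval : ∀ᵐ x : ℝ, (μHE[d - 1] : Measure (Vec d)) (simplex T ∩ (AffineSubspace.mk' (x • n +ᵥ p)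
      (Submodule.span ℝ {n})ᗮ : Set (Vec d))) = (Set.Ioc 0 h).indicator (fun x =>
        ENNReal.ofReal ((x / h) ^ (d - 1)) *
          (μHE[d - 1] : Measure (Vec d)) (simplex (T.erase p))) x := by
    -- The slice through the apex would need a homothety of ratio zero; it is discarded as a null
    -- set of parameters.
    have h0 : ∀ᵐ x : ℝ, x ≠ 0 := by simp [ae_iff]
    filter_upwards [h0] with x hx
    rw [hslice]
    by_cases hx' : x ∈ Set.Ioc 0 h
    · have hc : 0 < x / h := div_pos hx'.1 hh0
      have hc1 : x / h ≤ 1 := (div_le_one hh0).2 hx'.2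
      rw [Set.indicator_of_mem hx', hT.slice_eq_homothety hp hc hc1,
        euclideanHausdorffMeasure_homothety_image _ _ hc.ne', ENNReal.ofReal_pow hc.le,
        ENNReal.smul_def, smul_eq_mul, ENNReal.coe_pow]
      congr 2
      rw [Real.nnnorm_of_nonneg hc.le, ENNReal.ofReal, Real.toNNReal_of_nonneg hc.le]
    · rw [Set.indicator_of_notMem hx']
      have : {y ∈ simplex T | 1 - hT.bary p y = x / h} = ∅ := by
        rw [Set.eq_empty_iff_forall_notMem]
        rintro y ⟨hy, hyx⟩
        have hy' := hT.mem_simplex.1 hy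
        have hp0 := hy' p hp
        have hp1 : hT.bary p y ≤ 1 := by
          rw [← hT.sum_bary y]
          exact Finset.single_le_sum hy' hp
        apply hx'
        have : x = h * (1 - hT.bary p y) := by rw [hyx]; field_simp
        have hx0 : 0 ≤ x := by rw [this]; exact mul_nonneg hh0.le (by linarith)
        refine ⟨lt_of_le_of_ne hx0 hx.symm, ?_⟩
        rw [this]; nlinarith
      rw [this, measure_empty]
  rw [lintegral_congr_ae hval, lintegral_indicator measurableSet_Ioc, lintegral_mul_const,
    lintegral_pyramid hh0]
  · congr 3
    have : ((d - 1 : ℕ) : ℝ) + 1 = d := by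
      rw [Nat.cast_sub hd]; simp
    rw [this]
  · fun_prop

/-- The surface measure of the side of `T` opposite to `p`. -/
theorem height_mul_area (hd : 0 < d) {p : Vec d} (hp : p ∈ T) :
    hT.height hd hp * (μHE[d - 1] : Measure (Vec d)).real (simplex (T.erase p))
      = d * volume.real (simplex T) := by
  have hd' : (0 : ℝ) < d := by exact_mod_cast hd
  rw [Measure.real, Measure.real, hT.measure_pyramid hd hp, ENNReal.toReal_mul,
    ENNReal.toReal_ofReal (div_nonneg (hT.height_pos hd hp).le hd'.le)]
  field_simp

/-- The gradient of `λ_p` is `-n / h`, and the height is eliminated by `h |S| = d |T|`. This turns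
normal components into derivatives of barycentric coordinates. -/
theorem area_mul_inner (hd : 0 < d) {p : Vec d} (hp : p ∈ T) (w : Vec d) :
    (μHE[d - 1] : Measure (Vec d)).real (simplex (T.erase p)) *
      inner ℝ (outerNormal T (T.erase p)) w
      = -(d * volume.real (simplex T)) * (hT.bary p).linear w := by
  rw [hT.inner_outerNormal hd hp, ← hT.height_mul_area hd hp]; ring

theorem area_pos (hd : 0 < d) {p : Vec d} (hp : p ∈ T) :
    0 < (μHE[d - 1] : Measure (Vec d)).real (simplex (T.erase p)) :=
  hausdorff_simplex_real_pos (by rw [hT.card_erase hp]; omega)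
    (hT.indep_of_subset (Finset.erase_subset p T))

theorem sideAvg_affine (hd : 0 < d) {p : Vec d} (hp : p ∈ T)
    {F : Type*} [NormedAddCommGroup F] [NormedSpace ℝ F] [CompleteSpace F] (v : Vec d →ᵃ[ℝ] F) :
    Triangulation.sideAvg (T.erase p) v = (d : ℝ)⁻¹ • ∑ q ∈ T.erase p, v q := by
  rw [Triangulation.sideAvg, hausdorff_setAverage_affine (by rw [hT.card_erase hp]; omega)
    (hT.indep_of_subset (Finset.erase_subset p T))]
  congr 2
  rw [Nat.cast_sub hd]; simp

theorem elemAvg_affine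
    {F : Type*} [NormedAddCommGroup F] [NormedSpace ℝ F] [CompleteSpace F] (v : Vec d →ᵃ[ℝ] F) :
    Triangulation.elemAvg T v = ((d : ℝ) + 1)⁻¹ • ∑ q ∈ T, v q :=
  hT.setAverage_affine v

end Nondeg

/-! ### The discrete Gauss theorem on an element and interpolation of side values -/

/-- The `i`-th row of a matrix. -/
def row {l d : ℕ} (i : Fin l) : Mat l d →ₗ[ℝ] Vec d where
  toFun A := WithLp.toLp 2 fun j => A (i, j)
  map_add' _ _ := rfl
  map_smul' _ _ := rfl

@[simp]
theorem row_apply {l d : ℕ} (i : Fin l) (A : Mat l d) (j : Fin d) : row i A j = A (i, j) := rfl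

/-- The affine map `x ↦ L x + c`. -/
def affineOf {d : ℕ} {F : Type*} [AddCommGroup F] [Module ℝ F] (L : Vec d →ₗ[ℝ] F) (c : F) :
    Vec d →ᵃ[ℝ] F where
  toFun x := L x + c
  linear := L
  map_vadd' p v := by simp [add_assoc]

theorem affineOf_apply {d : ℕ} {F : Type*} [AddCommGroup F] [Module ℝ F] (L : Vec d →ₗ[ℝ] F)
    (c : F) (x : Vec d) : affineOf L c x = L x + c := rfl

theorem matVec_apply {l d : ℕ} (A : Mat l d) (w : Vec d) (i : Fin l) :
    matVec A w i = inner ℝ w (row i A) := by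
  simp [matVec, PiLp.inner_apply]

theorem inner_vec {l : ℕ} (a b : Vec l) : inner ℝ a b = ∑ i, a i * b i := by
  simp [PiLp.inner_apply, mul_comm]

theorem inner_mat {l d : ℕ} (A B : Mat l d) : inner ℝ A B = ∑ i, ∑ j, A (i, j) * B (i, j) := by
  simp [PiLp.inner_apply, mul_comm, Fintype.sum_prod_type]

theorem eq_sum_single {d : ℕ} (w : Vec d) : w = ∑ j, w j • EuclideanSpace.single j (1 : ℝ) := by
  ext i
  simp [Pi.single_apply]

/-- `outer b` as a linear map. -/
def outerLin {l d : ℕ} (b : Vec l) : Vec d →ₗ[ℝ] Mat l d where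
  toFun w := outer b w
  map_add' w w' := by ext p; simp [outer, mul_add]
  map_smul' c w := by ext p; simp [outer, mul_left_comm]

@[simp]
theorem outerLin_apply {l d : ℕ} (b : Vec l) (w : Vec d) : outerLin b w = outer b w := rfl

/-- `matVec A` as a linear map. -/
def matVecLin {l d : ℕ} (A : Mat l d) : Vec d →ₗ[ℝ] Vec l where
  toFun w := matVec A w
  map_add' w w' := by ext i; simp [matVec, mul_add, Finset.sum_add_distrib]
  map_smul' c w := by ext i; simp [matVec, mul_left_comm, Finset.mul_sum]

@[simp]
theorem matVecLin_apply {l d : ℕ} (A : Mat l d) (w : Vec d) : matVecLin A w = matVec A w := rfl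

theorem matVec_outer {l d : ℕ} (b : Vec l) (w n : Vec d) :
    matVec (outer b w) n = (inner ℝ n w : ℝ) • b := by
  ext i
  simp only [matVec, outer, inner_vec, PiLp.smul_apply, smul_eq_mul, Finset.sum_mul]
  exact Finset.sum_congr rfl fun j _ => by ring

theorem matVec_add {l d : ℕ} (A B : Mat l d) (n : Vec d) :
    matVec (A + B) n = matVec A n + matVec B n := by
  ext i; simp [matVec, add_mul, Finset.sum_add_distrib]

theorem matVec_smul {l d : ℕ} (c : ℝ) (A : Mat l d) (n : Vec d) :
    matVec (c • A) n = c • matVec A n := by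
  ext i; simp [matVec, Finset.mul_sum, mul_assoc]

theorem matVec_zero {l d : ℕ} (n : Vec d) : matVec (0 : Mat l d) n = 0 := by
  ext i; simp [matVec]

theorem matVec_sum {l d : ℕ} {ι : Type*} (s : Finset ι) (A : ι → Mat l d) (n : Vec d) :
    matVec (∑ k ∈ s, A k) n = ∑ k ∈ s, matVec (A k) n := by
  classical
  induction s using Finset.induction_on with
  | empty => simp [matVec_zero]
  | insert a s ha ih => rw [Finset.sum_insert ha, Finset.sum_insert ha, matVec_add, ih]

/-- The integration by parts formula in vertex values, for one row of `y`: `c k j` stands for the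
derivative of `λ_k` in the direction `y(j)`. Since the vertices `j ≠ k` lie on the side opposite to
`k`, constancy of the normal component makes `c k j` independent of such `j`. The vanishing column
sums then determine the diagonal, and both sides reduce to `∑ α v - (∑ α) (∑ v)`. -/
theorem gauss_algebra {V : Type*} [DecidableEq V] {d : ℕ} (hd : 0 < d) {T : Finset V}
    (hT : T.card = d + 1) (c : V → V → ℝ) (α v : V → ℝ)
    (h1 : ∀ k ∈ T, ∀ j ∈ T, j ≠ k → c k j = α k) (h2 : ∀ j ∈ T, ∑ k ∈ T, c k j = 0) :
    ∑ p ∈ T, -(d : ℝ) * α p * ((d : ℝ)⁻¹ * ∑ q ∈ T.erase p, v q)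
      = ((d : ℝ) + 1)⁻¹ * (∑ k ∈ T, v k * ∑ j ∈ T, c k j + (∑ k ∈ T, c k k) * ∑ j ∈ T, v j) := by
  have hd' : (d : ℝ) ≠ 0 := by exact_mod_cast hd.ne'
  have hdiag : ∀ k ∈ T, c k k = α k - ∑ j ∈ T, α j := by
    intro k hk
    have h := h2 k hk
    rw [← Finset.add_sum_erase _ _ hk] at h
    rw [Finset.sum_congr rfl fun j hj => h1 j (Finset.mem_of_mem_erase hj) k hk
      (Finset.ne_of_mem_erase hj).symm] at h
    rw [← Finset.add_sum_erase _ α hk]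
    linarith
  have hrow : ∀ k ∈ T, ∑ j ∈ T, c k j = ((d : ℝ) + 1) * α k - ∑ j ∈ T, α j := by
    intro k hk
    rw [← Finset.add_sum_erase _ _ hk, hdiag k hk, Finset.sum_congr rfl fun j hj =>
      h1 k hk j (Finset.mem_of_mem_erase hj) (Finset.ne_of_mem_erase hj), Finset.sum_const,
      Finset.card_erase_of_mem hk, hT, nsmul_eq_mul]
    simp only [add_tsub_cancel_right]
    ring
  have hv : ∀ p ∈ T, ∑ q ∈ T.erase p, v q = ∑ q ∈ T, v q - v p := by
    intro p hp
    rw [← Finset.add_sum_erase _ v hp]; ring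
  have s1 : ∑ k ∈ T, v k * ∑ j ∈ T, c k j
      = ∑ k ∈ T, v k * (((d : ℝ) + 1) * α k - ∑ j ∈ T, α j) :=
    Finset.sum_congr rfl fun k hk => by rw [hrow k hk]
  have s2 : ∑ p ∈ T, -(d : ℝ) * α p * ((d : ℝ)⁻¹ * ∑ q ∈ T.erase p, v q)
      = ∑ p ∈ T, -(d : ℝ) * α p * ((d : ℝ)⁻¹ * (∑ q ∈ T, v q - v p)) :=
    Finset.sum_congr rfl fun p hp => by rw [hv p hp]
  rw [s1, s2, Finset.sum_congr rfl hdiag]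
  simp only [mul_sub, Finset.sum_sub_distrib, Finset.sum_const, hT, nsmul_eq_mul, ← Finset.sum_mul]
  push_cast
  have e1 : ∑ p ∈ T, v p * (((d : ℝ) + 1) * α p) = ((d : ℝ) + 1) * ∑ p ∈ T, v p * α p := by
    rw [Finset.mul_sum]; exact Finset.sum_congr rfl fun p _ => by ring
  have e2 : (∑ p ∈ T, -(d : ℝ) * α p) * ((d : ℝ)⁻¹ * ∑ q ∈ T, v q)
      = -(∑ p ∈ T, α p) * ∑ q ∈ T, v q := by
    rw [← Finset.mul_sum]
    field_simp
  have e3 : ∑ p ∈ T, -(d : ℝ) * α p * ((d : ℝ)⁻¹ * v p) = -∑ p ∈ T, v p * α p := by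
    rw [← Finset.sum_neg_distrib]
    exact Finset.sum_congr rfl fun p _ => by field_simp
  have hd1 : (d : ℝ) + 1 ≠ 0 := by positivity
  rw [e1, e2, e3]
  field_simp
  ring

theorem sum_powersetCard_erase {V M : Type*} [DecidableEq V] [AddCommMonoid M] {d : ℕ}
    {T : Finset V} (hT : T.card = d + 1) (f : Finset V → M) :
    ∑ S ∈ T.powersetCard d, f S = ∑ p ∈ T, f (T.erase p) := by
  refine (Finset.sum_bij (fun p _ => T.erase p) ?_ ?_ ?_ fun _ _ => rfl).symm
  · intro p hp
    rw [Finset.mem_powersetCard, Finset.card_erase_of_mem hp, hT]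
    exact ⟨Finset.erase_subset _ _, rfl⟩
  · intro p hp q hq h
    by_contra hne
    have : p ∈ T.erase q := Finset.mem_erase.2 ⟨hne, hp⟩
    rw [← h] at this
    exact Finset.notMem_erase p T this
  · intro S hS
    rw [Finset.mem_powersetCard] at hS
    have : (T \ S).card = 1 := by rw [Finset.card_sdiff_of_subset hS.1]; omega
    obtain ⟨p, hp⟩ := Finset.card_eq_one.1 this
    have hpm : p ∈ T \ S := by rw [hp]; exact Finset.mem_singleton_self p
    refine ⟨p, (Finset.mem_sdiff.1 hpm).1, ?_⟩
    rw [Finset.erase_eq, ← hp, Finset.sdiff_sdiff_eq_self hS.1]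

theorem exists_eq_erase {V : Type*} [DecidableEq V] {d : ℕ}
    {T S : Finset V} (hT : T.card = d + 1) (hS : S ⊆ T) (hc : S.card = d) :
    ∃ p ∈ T, p ∉ S ∧ S = T.erase p := by
  have : (T \ S).card = 1 := by rw [Finset.card_sdiff_of_subset hS]; omega
  obtain ⟨p, hp⟩ := Finset.card_eq_one.1 this
  have hpm : p ∈ T \ S := by rw [hp]; exact Finset.mem_singleton_self p
  refine ⟨p, (Finset.mem_sdiff.1 hpm).1, (Finset.mem_sdiff.1 hpm).2, ?_⟩
  rw [Finset.erase_eq, ← hp, Finset.sdiff_sdiff_eq_self hS]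

namespace Nondeg

variable {d l : ℕ} {T : Finset (Vec d)} (hT : Nondeg T)
include hT

/-- Row `i` of `A` paired with the gradient is the derivative of `v_i` along that row, which is
expanded in vertex values. -/
theorem grad_inner (v : Vec d →ᵃ[ℝ] Vec l) (A : Mat l d) :
    inner ℝ A (Triangulation.grad v)
      = ∑ i, ∑ p ∈ T, (hT.bary p).linear (row i A) * v p i := by
  rw [inner_mat]
  refine Finset.sum_congr rfl fun i _ => ?_
  have h : v.linear (row i A) i = ∑ p ∈ T, (hT.bary p).linear (row i A) * v p i := by
    rw [hT.affine_linear_eq_sum v]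
    simp
  rw [← h, eq_sum_single (row i A)]
  simp [Triangulation.grad]

theorem div_apply (y : Vec d →ᵃ[ℝ] Mat l d) (i : Fin l) :
    Triangulation.div y i = ∑ p ∈ T, (hT.bary p).linear (row i (y p)) := by
  have h : ∀ p, (hT.bary p).linear (row i (y p))
      = ∑ j, (hT.bary p).linear (EuclideanSpace.single j 1) * y p (i, j) := by
    intro p
    conv_lhs => rw [eq_sum_single (row i (y p))]
    simp [mul_comm]
  simp only [h]
  rw [Finset.sum_comm]
  simp only [Triangulation.div]
  refine Finset.sum_congr rfl fun j _ => ?_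
  rw [hT.affine_linear_eq_sum y]
  simp

/-- Integration by parts on an element for an affine vector field `v` and an affine matrix field `y`
with constant normal components on the sides. -/
theorem gauss (hd : 0 < d) (v : Vec d →ᵃ[ℝ] Vec l) (y : Vec d →ᵃ[ℝ] Mat l d) (N : Vec d → Vec l)
    (hN : ∀ p ∈ T, ∀ x ∈ simplex (T.erase p), matVec (y x) (outerNormal T (T.erase p)) = N p) :
    ∑ p ∈ T, (μHE[d - 1] : Measure (Vec d)).real (simplex (T.erase p)) *
        inner ℝ (N p) (Triangulation.sideAvg (T.erase p) v)
      = volume.real (simplex T) * (inner ℝ (Triangulation.elemAvg T y) (Triangulation.grad v)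
          + inner ℝ (Triangulation.div y) (Triangulation.elemAvg T v)) := by
  have hd' : (d : ℝ) ≠ 0 := by exact_mod_cast hd.ne'
  set τ := volume.real (simplex T) with hτ
  have hτ0 : τ ≠ 0 := hT.volume_real_pos.ne'
  let area := fun p => (μHE[d - 1] : Measure (Vec d)).real (simplex (T.erase p))
  -- By `area_mul_inner` this is the common derivative of `λ_p` along row `i` of `y` at the vertices
  -- of the side opposite to `p`.
  let α : Fin l → Vec d → ℝ := fun i p => -(d * τ)⁻¹ * (area p * N p i)
  have hα : ∀ i, ∀ k ∈ T, ∀ j ∈ T, j ≠ k → (hT.bary k).linear (row i (y j)) = α i k := by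
    intro i k hk j hj hjk
    have h := hN k hk j (subset_convexHull ℝ _ (Finset.mem_erase.2 ⟨hjk, hj⟩))
    have h' := hT.area_mul_inner hd hk (row i (y j))
    rw [← matVec_apply, h] at h'
    simp only [α, area]
    rw [h', ← hτ]
    field_simp
  have key := fun i => gauss_algebra hd hT.card_eq (fun k j => (hT.bary k).linear (row i (y j)))
    (α i) (fun p => v p i) (hα i) (fun j _ => hT.sum_bary_linear _)
  have e1 : ∀ p ∈ T, area p * inner ℝ (N p) (Triangulation.sideAvg (T.erase p) v)
      = ∑ i, τ * (-(d : ℝ) * α i p * ((d : ℝ)⁻¹ * ∑ q ∈ T.erase p, v q i)) := by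
    intro p hp
    rw [hT.sideAvg_affine hd hp, inner_vec, Finset.mul_sum]
    refine Finset.sum_congr rfl fun i _ => ?_
    simp only [α, PiLp.smul_apply, WithLp.ofLp_sum, Finset.sum_apply, smul_eq_mul]
    field_simp
  rw [Finset.sum_congr rfl e1, Finset.sum_comm, hT.grad_inner, inner_vec,
    ← Finset.sum_add_distrib, Finset.mul_sum]
  refine Finset.sum_congr rfl fun i _ => ?_
  rw [← Finset.mul_sum, key i, hT.div_apply, hT.elemAvg_affine, hT.elemAvg_affine]
  congr 1
  simp only [map_smul, map_sum, PiLp.smul_apply, WithLp.ofLp_sum, Finset.sum_apply, smul_eq_mul]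
  rw [mul_add, Finset.mul_sum]
  congr 1
  · exact Finset.sum_congr rfl fun k _ => by ring
  · ring

theorem exists_interp {F : Type*} [AddCommGroup F] [Module ℝ F] (f : Vec d → F) :
    ∃ v : Vec d →ᵃ[ℝ] F, ∀ q ∈ T, v q = f q := by
  refine ⟨affineOf (∑ p ∈ T, (hT.bary p).linear.smulRight (f p)) (∑ p ∈ T, hT.bary p 0 • f p),
    fun q hq => ?_⟩
  have e : ∀ p, (hT.bary p).linear q + hT.bary p 0 = hT.bary p q := fun p => by
    simpa using ((hT.bary p).map_vadd 0 q).symm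
  rw [affineOf_apply, LinearMap.sum_apply, ← Finset.sum_add_distrib]
  simp only [LinearMap.smulRight_apply, ← add_smul, e]
  rw [Finset.sum_eq_single_of_mem q hq, hT.bary_self hq, one_smul]
  intro p hp hpq
  rw [hT.bary_ne hp hq hpq, zero_smul]

/-- There is an affine function with given mean values on the sides. -/
theorem exists_sideAvg_eq (hd : 0 < d) (α : Finset (Vec d) → Vec l) :
    ∃ v : Vec d →ᵃ[ℝ] Vec l, ∀ p ∈ T, Triangulation.sideAvg (T.erase p) v = α (T.erase p) := by
  have hd' : (d : ℝ) ≠ 0 := by exact_mod_cast hd.ne'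
  -- These vertex values invert the relation that the mean over the side opposite to `p` is `1/d`
  -- times the sum of the values at `q ≠ p`.
  obtain ⟨v, hv⟩ := hT.exists_interp fun q => (∑ p ∈ T, α (T.erase p)) - (d : ℝ) • α (T.erase q)
  refine ⟨v, fun p hp => ?_⟩
  rw [hT.sideAvg_affine hd hp, Finset.sum_congr rfl fun q hq =>
    hv q (Finset.mem_of_mem_erase hq), Finset.sum_sub_distrib, Finset.sum_const,
    hT.card_erase hp, ← Finset.smul_sum, ← Finset.add_sum_erase _ _ hp,
    ← Nat.cast_smul_eq_nsmul ℝ, ← smul_sub, smul_smul, inv_mul_cancel₀ hd', one_smul]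
  abel

/-- There is an affine matrix field with given normal components on the sides. -/
theorem exists_normal_eq (hd : 0 < d) (β : Finset (Vec d) → Vec l) :
    ∃ y : Vec d →ᵃ[ℝ] Mat l d, ∀ p ∈ T, ∀ x ∈ simplex (T.erase p),
      matVec (y x) (outerNormal T (T.erase p)) = β (T.erase p) := by
  -- The field is `∑_p h_p⁻¹ β_p ⊗ (x - p)`. On the side opposite to `p`, `(x - q) · n` is zero for
  -- the vertices `q ≠ p`, which lie on that side, and equals `h_p` for `q = p`.
  let A : Vec d →ₗ[ℝ] Mat l d :=
    ∑ p ∈ T.attach, (hT.height hd p.2)⁻¹ • outerLin (β (T.erase p))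
  let C : Mat l d := ∑ p ∈ T.attach, (hT.height hd p.2)⁻¹ • outer (β (T.erase p)) p.1
  refine ⟨affineOf A (-C), fun p hp x hx => ?_⟩
  have e : affineOf A (-C) x
      = ∑ q ∈ T.attach, (hT.height hd q.2)⁻¹ • outer (β (T.erase q)) (x - q.1) := by
    have : ∀ q : {q // q ∈ T}, outer (β (T.erase q)) (x - q.1)
        = outer (β (T.erase q)) x - outer (β (T.erase q)) q.1 := fun q =>
      (outerLin (β (T.erase q))).map_sub x q.1
    simp only [this, smul_sub, Finset.sum_sub_distrib]
    rw [affineOf_apply, ← sub_eq_add_neg, LinearMap.sum_apply]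
    rfl
  rw [e, matVec_sum, Finset.sum_eq_single_of_mem ⟨p, hp⟩ (Finset.mem_attach _ _)]
  · rw [matVec_smul, matVec_outer, hT.inner_outerNormal hd hp, affine_sub, hT.bary_self hp,
      ((hT.mem_simplex_erase hp).1 hx).2, smul_smul]
    have := (hT.height_pos hd hp).ne'
    rw [show (hT.height hd hp)⁻¹ * (-hT.height hd hp * (0 - 1)) = 1 by field_simp; ring, one_smul]
  · rintro ⟨q, hq⟩ - hne
    have hne' : p ≠ q := fun h => hne (by simp [h])
    rw [matVec_smul, matVec_outer, hT.inner_outerNormal hd hp, affine_sub, hT.bary_ne hp hq hne',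
      ((hT.mem_simplex_erase hp).1 hx).2]
    simp

theorem elemAvg_id : Triangulation.elemAvg T id = ((d : ℝ) + 1)⁻¹ • ∑ q ∈ T, q :=
  hT.elemAvg_affine (AffineMap.id ℝ (Vec d))

/-- The mean of an affine function is its value at the barycentre; the reconstructed fields are
therefore expanded about that point. -/
theorem elemAvg_eq_apply {F : Type*} [NormedAddCommGroup F] [NormedSpace ℝ F] [CompleteSpace F]
    (v : Vec d →ᵃ[ℝ] F) :
    Triangulation.elemAvg T v = v (Triangulation.elemAvg T id) := by
  have hne : T.Nonempty := by rw [← Finset.card_pos, hT.card_eq]; omega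
  have := affine_mean hne v
  rw [hT.card_eq] at this
  push_cast at this
  rw [hT.elemAvg_affine, hT.elemAvg_id, this]

end Nondeg

/-- The field `A + b ⊗ (x - x₀) / d`. -/
def rtField {l d : ℕ} (A : Mat l d) (b : Vec l) (x₀ : Vec d) : Vec d →ᵃ[ℝ] Mat l d :=
  affineOf (outerLin ((d : ℝ)⁻¹ • b)) (A - outer ((d : ℝ)⁻¹ • b) x₀)

theorem rtField_apply {l d : ℕ} (A : Mat l d) (b : Vec l) (x₀ x : Vec d) :
    rtField A b x₀ x = A + outer ((d : ℝ)⁻¹ • b) (x - x₀) := by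
  have : outer ((d : ℝ)⁻¹ • b) (x - x₀) = outer ((d : ℝ)⁻¹ • b) x - outer ((d : ℝ)⁻¹ • b) x₀ :=
    (outerLin ((d : ℝ)⁻¹ • b)).map_sub x x₀
  rw [this]
  rw [rtField, affineOf_apply, outerLin_apply]
  abel

theorem div_rtField {l d : ℕ} (hd : 0 < d) (A : Mat l d) (b : Vec l) (x₀ : Vec d) :
    Triangulation.div (rtField A b x₀) = b := by
  have hd' : (d : ℝ) ≠ 0 := by exact_mod_cast hd.ne'
  have h : (rtField A b x₀).linear = outerLin ((d : ℝ)⁻¹ • b) := rfl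
  ext i
  simp only [Triangulation.div, h]
  simp [outer]
  field_simp

/-- The field `b + A (x - x₀)`. -/
def crField {l d : ℕ} (A : Mat l d) (b : Vec l) (x₀ : Vec d) : Vec d →ᵃ[ℝ] Vec l :=
  affineOf (matVecLin A) (b - matVec A x₀)

theorem crField_apply {l d : ℕ} (A : Mat l d) (b : Vec l) (x₀ x : Vec d) :
    crField A b x₀ x = b + matVec A (x - x₀) := by
  have : matVec A (x - x₀) = matVec A x - matVec A x₀ := (matVecLin A).map_sub x x₀
  rw [this]
  rw [crField, affineOf_apply, matVecLin_apply]
  abel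

theorem grad_crField {l d : ℕ} (A : Mat l d) (b : Vec l) (x₀ : Vec d) :
    Triangulation.grad (crField A b x₀) = A := by
  have h : (crField A b x₀).linear = matVecLin A := rfl
  ext ⟨i, j⟩
  simp only [Triangulation.grad, h]
  simp [matVec]

/-! ### Sides of a triangulation -/

open Filter Topology

theorem affine_lineMap {d : ℕ} (f : Vec d →ᵃ[ℝ] ℝ) (a b : Vec d) (t : ℝ) :
    f (AffineMap.lineMap a b t) = (1 - t) * f a + t * f b := by
  rw [AffineMap.apply_lineMap, AffineMap.lineMap_apply]
  simp only [vsub_eq_sub, smul_eq_mul, vadd_eq_add]; ring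

/-- The mean of the points of `S`. -/
def centre {d : ℕ} (S : Finset (Vec d)) : Vec d := (S.card : ℝ)⁻¹ • ∑ p ∈ S, p

theorem continuous_line {d : ℕ} (a b : Vec d) :
    Continuous fun t : ℝ => AffineMap.lineMap (k := ℝ) a b t := AffineMap.lineMap_continuous

namespace Nondeg

variable {d : ℕ} {T : Finset (Vec d)} (hT : Nondeg T)
include hT

theorem bary_centre_self (hd : 0 < d) {p : Vec d} (hp : p ∈ T) :
    hT.bary p (centre (T.erase p)) = 0 := by
  rw [centre, affine_mean (hT.erase_nonempty hd hp)]
  rw [Finset.sum_eq_zero fun q hq => hT.bary_ne hp (Finset.mem_of_mem_erase hq)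
    (Finset.ne_of_mem_erase hq).symm, smul_zero]

theorem bary_centre_pos (hd : 0 < d) {p q : Vec d} (hp : p ∈ T) (hq : q ∈ T.erase p) :
    0 < hT.bary q (centre (T.erase p)) := by
  rw [centre, affine_mean (hT.erase_nonempty hd hp), Finset.sum_eq_single_of_mem q hq,
    hT.bary_self (Finset.mem_of_mem_erase hq), hT.card_erase hp]
  · have : (0 : ℝ) < d := by exact_mod_cast hd
    simpa using this
  · intro r hr hrq
    exact hT.bary_ne (Finset.mem_of_mem_erase hq) (Finset.mem_of_mem_erase hr) hrq.symm

theorem centre_mem (hd : 0 < d) {p : Vec d} (hp : p ∈ T) :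
    centre (T.erase p) ∈ simplex (T.erase p) :=
  (hT.mem_simplex_erase hp).2 ⟨fun _ hq hqp =>
    (hT.bary_centre_pos hd hp (Finset.mem_erase.2 ⟨hqp, hq⟩)).le, hT.bary_centre_self hd hp⟩

theorem eventually_bary_pos (S : Finset (Vec d)) {x : Vec d} (hx : ∀ q ∈ S, 0 < hT.bary q x) :
    ∀ᶠ y in 𝓝 x, ∀ q ∈ S, 0 < hT.bary q y :=
  (Finset.eventually_all S).2 fun q hq =>
    (hT.continuous_bary q).continuousAt.eventually (lt_mem_nhds (hx q hq))

theorem mem_simplex_of_erase {p : Vec d} {x : Vec d} (h : ∀ q ∈ T.erase p, 0 < hT.bary q x)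
    (hx : 0 ≤ hT.bary p x) : x ∈ simplex T := by
  rw [hT.mem_simplex]
  intro q hq
  by_cases hqp : q = p
  · rw [hqp]; exact hx
  · exact (h q (Finset.mem_erase.2 ⟨hqp, hq⟩)).le

/-- The barycentric coordinates of two simplices with a common side. -/
theorem bary_eq_mul {T' : Finset (Vec d)} (hT' : Nondeg T') {p p' : Vec d} (hp : p ∈ T)
    (hp' : p' ∈ T') (h : T.erase p = T'.erase p') (y : Vec d) :
    hT.bary p y = hT.bary p p' * hT'.bary p' y := by
  rw [hT'.affine_eq_sum (hT.bary p) y, Finset.sum_eq_single_of_mem p' hp', smul_eq_mul, mul_comm]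
  intro q hq hqp
  have : q ∈ T.erase p := by rw [h]; exact Finset.mem_erase.2 ⟨hqp, hq⟩
  rw [hT.bary_ne hp (Finset.mem_of_mem_erase this) (Finset.ne_of_mem_erase this).symm, smul_zero]

end Nondeg

namespace Triangulation

variable {d : ℕ} {Ω : Set (Vec d)} (Th : Triangulation Ω)

theorem nondeg {T : Finset (Vec d)} (hT : T ∈ Th.elements) : Nondeg T :=
  ⟨Th.card_eq T hT, Th.indep T hT⟩

theorem simplex_subset_closure {T : Finset (Vec d)} (hT : T ∈ Th.elements) :
    simplex T ⊆ closure Ω := by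
  rw [Th.cover]
  exact Set.subset_biUnion_of_mem (u := fun T => simplex T) hT

theorem simplex_inter {T T' : Finset (Vec d)} (hT : T ∈ Th.elements) (hT' : T' ∈ Th.elements) :
    simplex T ∩ simplex T' = simplex (T ∩ T') := by
  rw [Th.conforming T hT T' hT', simplex, Finset.coe_inter]

theorem notMem_of_erase {T T' : Finset (Vec d)} (hT : T ∈ Th.elements) (hT' : T' ∈ Th.elements)
    (hne : T ≠ T') {p : Vec d} (hS : T.erase p ⊆ T') : p ∉ T' := by
  intro h
  apply hne
  refine Finset.eq_of_subset_of_card_le (fun q hq => ?_)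
    (by rw [Th.card_eq T hT, Th.card_eq T' hT'])
  by_cases hqp : q = p
  · rw [hqp]; exact h
  · exact hS (Finset.mem_erase.2 ⟨hqp, hq⟩)

/-- Two elements with a common side lie on different sides of it. -/
theorem bary_opposite_neg (hd : 0 < d) {T T' : Finset (Vec d)} (hT : T ∈ Th.elements)
    (hT' : T' ∈ Th.elements) (hne : T ≠ T') {p p' : Vec d} (hp : p ∈ T) (hp' : p' ∈ T')
    (h : T.erase p = T'.erase p') : (Th.nondeg hT).bary p p' < 0 := by
  have nT := Th.nondeg hT
  have nT' := Th.nondeg hT'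
  by_contra! hnn
  -- If `λ_p(p') > 0`, a short step from the centre of the common side towards `p'` stays in both
  -- elements with `λ_p > 0`. By conformity the point lies in the simplex of the common vertices,
  -- where `λ_p = 0`.
  rcases hnn.lt_or_eq with hpos | hzero
  · set b := centre (T.erase p) with hb
    have ev : ∀ᶠ t in 𝓝[>] (0 : ℝ), ∀ q ∈ T.erase p,
        0 < nT.bary q (AffineMap.lineMap (k := ℝ) b p' t) := by
      have h1 := nT.eventually_bary_pos (T.erase p) (x := b)
        fun q hq => nT.bary_centre_pos hd hp hq
      have h2 : Tendsto (fun t : ℝ => AffineMap.lineMap (k := ℝ) b p' t) (𝓝[>] 0) (𝓝 b) := by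
        have := (continuous_line b p').tendsto 0
        rw [AffineMap.lineMap_apply_zero] at this
        exact this.mono_left nhdsWithin_le_nhds
      exact h2.eventually h1
    have ev1 : ∀ᶠ t in 𝓝[>] (0 : ℝ), t < 1 :=
      (gt_mem_nhds (zero_lt_one' ℝ)).filter_mono nhdsWithin_le_nhds
    obtain ⟨t, h1, h2, h3⟩ := (ev.and (ev1.and self_mem_nhdsWithin)).exists
    set y := AffineMap.lineMap (k := ℝ) b p' t
    have h3' : 0 < t := h3
    have hyp : 0 < nT.bary p y := by
      rw [affine_lineMap, nT.bary_centre_self hd hp]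
      simpa using mul_pos h3' hpos
    have hyT : y ∈ simplex T := nT.mem_simplex_of_erase h1 hyp.le
    have hyT' : y ∈ simplex T' := by
      refine (convex_simplex T').lineMap_mem ?_ (subset_convexHull ℝ _ hp') ⟨h3'.le, h2.le⟩
      rw [hb, h]
      exact convexHull_mono (Finset.coe_subset.2 (Finset.erase_subset _ _))
        (nT'.centre_mem hd hp')
    have hy : y ∈ simplex (T ∩ T') := by
      rw [← Th.simplex_inter hT hT']; exact ⟨hyT, hyT'⟩
    have := ((nT.mem_simplex_of_subset Finset.inter_subset_left).1 hy).2 p hp (by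
      rw [Finset.mem_inter]
      exact fun h' => Th.notMem_of_erase hT hT' hne (h ▸ Finset.erase_subset _ _) h'.2)
    linarith
  -- If `λ_p(p') = 0`, then `λ_p` vanishes identically, contrary to `λ_p(p) = 1`.
  · have := nT.bary_eq_mul nT' hp hp' h p
    rw [nT.bary_self hp, ← hzero] at this
    norm_num at this

/-- Near the centre, the coordinates at the vertices of the side stay positive in both elements,
while the two opposite coordinates have opposite signs. So every nearby point lies in one of the
elements, and the centre is interior to `closure Ω`. -/
theorem centre_mem_of_common_side (hΩ : interior (closure Ω) = Ω) (hd : 0 < d)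
    {T T' : Finset (Vec d)} (hT : T ∈ Th.elements)
    (hT' : T' ∈ Th.elements) (hne : T ≠ T') {p p' : Vec d} (hp : p ∈ T) (hp' : p' ∈ T')
    (h : T.erase p = T'.erase p') : centre (T.erase p) ∈ Ω := by
  have nT := Th.nondeg hT
  have nT' := Th.nondeg hT'
  rw [← hΩ, mem_interior_iff_mem_nhds]
  have h1 := nT.eventually_bary_pos (T.erase p) (x := centre (T.erase p))
    fun q hq => nT.bary_centre_pos hd hp hq
  have h2 := nT'.eventually_bary_pos (T'.erase p') (x := centre (T.erase p))
    fun q hq => by rw [h]; exact nT'.bary_centre_pos hd hp' hq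
  filter_upwards [h1, h2] with y hy hy'
  rcases le_or_gt 0 (nT.bary p y) with hpos | hneg
  · exact Th.simplex_subset_closure hT (nT.mem_simplex_of_erase hy hpos)
  · refine Th.simplex_subset_closure hT' (nT'.mem_simplex_of_erase hy' ?_)
    have e := nT.bary_eq_mul nT' hp hp' h y
    have := Th.bary_opposite_neg hd hT hT' hne hp hp' h
    nlinarith

/-- A second element would put the centre of the side into the open set `Ω`, but it lies in the
frontier. -/
theorem unique_of_isBoundarySide (hΩ : interior (closure Ω) = Ω) (hd : 0 < d)
    {S : Finset (Vec d)} (hS : Th.IsBoundarySide S) {T T' : Finset (Vec d)} (hT : T ∈ Th.elements)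
    (hT' : T' ∈ Th.elements) (h : S ⊆ T) (h' : S ⊆ T') : T = T' := by
  by_contra hne
  obtain ⟨p, hp, -, rfl⟩ := exists_eq_erase (Th.card_eq T hT) h hS.1
  obtain ⟨p', hp', -, he⟩ := exists_eq_erase (Th.card_eq T' hT') h' hS.1
  have h1 := Th.centre_mem_of_common_side hΩ hd hT hT' hne hp hp' he
  have h2 := hS.2.2 ((Th.nondeg hT).centre_mem hd hp)
  have hopen : IsOpen Ω := hΩ ▸ isOpen_interior
  rw [hopen.frontier_eq] at h2
  exact h2.2 h1

/-- A hyperplane has only two sides. Three elements would have pairwise separated opposite vertices,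
yet `λ_p(p'') = λ_p(p') λ'_{p'}(p'')` is a product of two negative numbers. -/
theorem common_side_at_most_two (hd : 0 < d) {S : Finset (Vec d)} (hS : S.card = d)
    {T T' T'' : Finset (Vec d)} (hT : T ∈ Th.elements) (hT' : T' ∈ Th.elements)
    (hT'' : T'' ∈ Th.elements) (h : S ⊆ T) (h' : S ⊆ T') (h'' : S ⊆ T'')
    (hne : T ≠ T') (hne1 : T'' ≠ T) : T'' = T' := by
  by_contra hne2
  obtain ⟨p, hp, -, e⟩ := exists_eq_erase (Th.card_eq T hT) h hS
  obtain ⟨p', hp', -, e'⟩ := exists_eq_erase (Th.card_eq T' hT') h' hS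
  obtain ⟨p'', hp'', -, e''⟩ := exists_eq_erase (Th.card_eq T'' hT'') h'' hS
  have h1 := Th.bary_opposite_neg hd hT hT' hne hp hp' (e ▸ e')
  have h2 := Th.bary_opposite_neg hd hT hT'' (Ne.symm hne1) hp hp'' (e ▸ e'')
  have h3 := Th.bary_opposite_neg hd hT' hT'' (Ne.symm hne2) hp' hp'' (e' ▸ e'')
  have h4 := (Th.nondeg hT).bary_eq_mul (Th.nondeg hT') hp hp' (e ▸ e') p''
  nlinarith

/-- Some point of the side lies in `Ω`, and moving it slightly towards the centre gives a point `z ∈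
Ω` in the relative interior. Points just beyond `z`, away from `p`, are covered by elements other
than `T`, so `z` lies in such an element `T'`. By conformity, the vertices with positive coordinate
at `z`, that is all of `S`, belong to `T'`. -/
theorem exists_neighbour (hΩ : interior (closure Ω) = Ω) (hd : 0 < d)
    {S T : Finset (Vec d)} (hT : T ∈ Th.elements) (hS : S ⊆ T) (hc : S.card = d)
    (hb : ¬ Th.IsBoundarySide S) : ∃ T' ∈ Th.elements, T ≠ T' ∧ S ⊆ T' := by
  have nT := Th.nondeg hT
  have hopen : IsOpen Ω := hΩ ▸ isOpen_interior
  have hsub : ¬ simplex S ⊆ frontier Ω := fun h => hb ⟨hc, ⟨T, hT, hS⟩, h⟩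
  obtain ⟨x, hxS, hxf⟩ := Set.not_subset.1 hsub
  obtain ⟨p, hp, -, rfl⟩ := exists_eq_erase (Th.card_eq T hT) hS hc
  have hxT : x ∈ simplex T := convexHull_mono (Finset.coe_subset.2 (Finset.erase_subset _ _)) hxS
  have hxΩ : x ∈ Ω := by
    by_contra h
    rw [hopen.frontier_eq] at hxf
    exact hxf ⟨Th.simplex_subset_closure hT hxT, h⟩
  obtain ⟨hx1, hx2⟩ := (nT.mem_simplex_erase hp).1 hxS
  -- a point of `Ω` in the relative interior of the side
  obtain ⟨z, hzΩ, hzq, hzp⟩ : ∃ z ∈ Ω, (∀ q ∈ T.erase p, 0 < nT.bary q z) ∧ nT.bary p z = 0 := by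
    have ev : ∀ᶠ t in 𝓝[>] (0 : ℝ), AffineMap.lineMap (k := ℝ) x (centre (T.erase p)) t ∈ Ω := by
      have := (continuous_line x (centre (T.erase p))).tendsto 0
      rw [AffineMap.lineMap_apply_zero] at this
      exact (this.mono_left nhdsWithin_le_nhds).eventually (hopen.mem_nhds hxΩ)
    have ev1 : ∀ᶠ t in 𝓝[>] (0 : ℝ), t < 1 :=
      (gt_mem_nhds (zero_lt_one' ℝ)).filter_mono nhdsWithin_le_nhds
    obtain ⟨t, h1, h2, h3⟩ := (ev.and (ev1.and self_mem_nhdsWithin)).exists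
    have h3' : 0 < t := h3
    refine ⟨_, h1, fun q hq => ?_, ?_⟩
    · rw [affine_lineMap]
      have a1 := hx1 q (Finset.mem_of_mem_erase hq) (Finset.ne_of_mem_erase hq)
      have a2 := nT.bary_centre_pos hd hp hq
      have := mul_pos h3' a2
      have := mul_nonneg (sub_nonneg.2 h2.le) a1
      linarith
    · rw [affine_lineMap, hx2, nT.bary_centre_self hd hp]; ring
  have hclosed : IsClosed (⋃ T' ∈ Th.elements.erase T, simplex T') :=
    isClosed_biUnion_finset fun T' _ => (isCompact_simplex T').isClosed
  have hz : z ∈ ⋃ T' ∈ Th.elements.erase T, simplex T' := by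
    have hlim : Tendsto (fun t : ℝ => AffineMap.lineMap (k := ℝ) z p t) (𝓝[<] 0) (𝓝 z) := by
      have := (continuous_line z p).tendsto 0
      rw [AffineMap.lineMap_apply_zero] at this
      exact this.mono_left nhdsWithin_le_nhds
    -- For `t < 0` the point has `λ_p = t < 0`, so the element covering it is not `T`; a finite
    -- union of closed simplices keeps the limit `z`.
    refine hclosed.mem_of_tendsto hlim ?_
    filter_upwards [hlim.eventually (hopen.mem_nhds hzΩ), self_mem_nhdsWithin] with t ht ht0
    have ht0' : t < 0 := ht0
    have hc := subset_closure ht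
    rw [Th.cover, Set.mem_iUnion₂] at hc
    obtain ⟨T', hT', hm⟩ := hc
    refine Set.mem_iUnion₂.2 ⟨T', Finset.mem_erase.2 ⟨?_, hT'⟩, hm⟩
    rintro rfl
    have := nT.mem_simplex.1 hm p hp
    rw [affine_lineMap, hzp, nT.bary_self hp] at this
    linarith
  obtain ⟨T', hT', hzT'⟩ := Set.mem_iUnion₂.1 hz
  obtain ⟨hne, hT'⟩ := Finset.mem_erase.1 hT'
  refine ⟨T', hT', hne.symm, fun q hq => ?_⟩
  have hzT : z ∈ simplex T := nT.mem_simplex_of_erase hzq hzp.ge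
  have hzi : z ∈ simplex (T ∩ T') := by
    rw [← Th.simplex_inter hT hT']; exact ⟨hzT, hzT'⟩
  by_contra hqT'
  have := ((nT.mem_simplex_of_subset Finset.inter_subset_left).1 hzi).2 q
    (Finset.mem_of_mem_erase hq) (fun h => hqT' (Finset.mem_inter.1 h).2)
  exact (hzq q hq).ne' this

/-- The interior of an element lies in `int (closure Ω) = Ω`, and the frontier of a convex set is
null. -/
theorem ae_simplex (hΩ : interior (closure Ω) = Ω) {T : Finset (Vec d)} (hT : T ∈ Th.elements)
    {P : Vec d → Prop} (h : ∀ᵐ x ∂(volume.restrict Ω), P x) :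
    ∀ᵐ x ∂(volume.restrict (simplex T)), P x := by
  refine ae_mono (Measure.restrict_mono_ae ?_) h
  have h0 : volume (frontier (simplex T)) = 0 := (convex_simplex T).addHaar_frontier volume
  have h1 : interior (simplex T) ⊆ Ω := by
    rw [← hΩ]; exact interior_mono (Th.simplex_subset_closure hT)
  filter_upwards [measure_eq_zero_iff_ae_notMem.1 h0] with x hx hxT
  refine h1 ?_
  by_contra h
  exact hx ⟨subset_closure hxT, h⟩

variable {ΓD ΓN : Set (Vec d)}

/-- The relative interior of a side is nonempty and would lie in two disjoint sets. -/
theorem not_isSideOn_both (hΓ : Th.IsBoundaryPartition ΓD ΓN) (hd : 0 < d) {S : Finset (Vec d)}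
    (h : Th.IsSideOn ΓD S) : ¬ Th.IsSideOn ΓN S := by
  intro h'
  have hne : (simplex S).Nonempty := by
    obtain ⟨q, hq⟩ : S.Nonempty := by rw [← Finset.card_pos, h.1.1]; exact hd
    exact ⟨q, subset_convexHull ℝ _ hq⟩
  obtain ⟨x, hx⟩ := hne.intrinsicInterior (convex_simplex S)
  exact Set.disjoint_left.1 hΓ.1 (h.2 hx) (h'.2 hx)

/-- The sum over the sides of all elements is the sum over the boundary sides if the contributions of
the inner sides cancel. -/
theorem sum_sides (hΩ : interior (closure Ω) = Ω) (hd : 0 < d)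
    (hΓ : Th.IsBoundaryPartition ΓD ΓN) (f : Th.elements → Finset (Vec d) → ℝ)
    (hf : ∀ T T' S, Th.IsInnerSide T T' S → f T S + f T' S = 0) :
    ∑ T : Th.elements, ∑ S ∈ T.1.powersetCard d, f T S = Th.sumSides ΓD f + Th.sumSides ΓN f := by
  classical
  have hsplit : ∀ T : Th.elements, ∑ S ∈ T.1.powersetCard d, f T S
      = ∑ S ∈ (T.1.powersetCard d).filter (Th.IsSideOn ΓD), f T S
        + ∑ S ∈ (T.1.powersetCard d).filter (Th.IsSideOn ΓN), f T S
        + ∑ S ∈ (T.1.powersetCard d).filter (fun S => ¬ Th.IsBoundarySide S), f T S := by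
    intro T
    rw [← Finset.sum_union, ← Finset.sum_union]
    · refine Finset.sum_congr ?_ fun _ _ => rfl
      ext S
      simp only [Finset.mem_union, Finset.mem_filter]
      constructor
      · intro hS
        by_cases hb : Th.IsBoundarySide S
        · rcases hΓ.2.2 S hb with h | h <;> simp [hS, h]
        · simp [hS, hb]
      · tauto
    · rw [Finset.disjoint_left]
      intro S h1 h2
      simp only [Finset.mem_union, Finset.mem_filter] at h1 h2
      rcases h1 with h1 | h1
      · exact h2.2 h1.2.1
      · exact h2.2 h1.2.1
    · rw [Finset.disjoint_left]
      intro S h1 h2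
      exact Th.not_isSideOn_both hΓ hd (Finset.mem_filter.1 h1).2 (Finset.mem_filter.1 h2).2
  rw [Finset.sum_congr rfl fun T _ => hsplit T, Finset.sum_add_distrib, Finset.sum_add_distrib]
  have hzero : ∑ T : Th.elements, ∑ S ∈ (T.1.powersetCard d).filter
      (fun S => ¬ Th.IsBoundarySide S), f T S = 0 := by
    -- Regroup by sides: each remaining side belongs to exactly two elements, whose contributions
    -- cancel.
    rw [Finset.sum_comm' (t' := (Finset.univ : Finset Th.elements).biUnion fun T =>
        (T.1.powersetCard d).filter (fun S => ¬ Th.IsBoundarySide S))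
      (s' := fun S => (Finset.univ : Finset Th.elements).filter fun T =>
        S ∈ (T.1.powersetCard d).filter (fun S => ¬ Th.IsBoundarySide S))]
    · refine Finset.sum_eq_zero fun S hS => ?_
      obtain ⟨T, -, hTS⟩ := Finset.mem_biUnion.1 hS
      obtain ⟨hTS, hb⟩ := Finset.mem_filter.1 hTS
      obtain ⟨hST, hc⟩ := Finset.mem_powersetCard.1 hTS
      obtain ⟨T', hT', hne, hST'⟩ := Th.exists_neighbour hΩ hd T.2 hST hc hb
      have hne' : T ≠ ⟨T', hT'⟩ := fun h => hne (congrArg Subtype.val h)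
      have : ((Finset.univ : Finset Th.elements).filter fun T =>
          S ∈ (T.1.powersetCard d).filter (fun S => ¬ Th.IsBoundarySide S))
          = {T, ⟨T', hT'⟩} := by
        ext T''
        simp only [Finset.mem_filter, Finset.mem_univ, true_and, Finset.mem_powersetCard,
          Finset.mem_insert, Finset.mem_singleton]
        constructor
        · rintro ⟨⟨h1, -⟩, -⟩
          by_cases hTT : T'' = T
          · exact Or.inl hTT
          · right
            exact Subtype.ext (Th.common_side_at_most_two hd hc T.2 hT' T''.2 hST hST' h1 hne
              fun h => hTT (Subtype.ext h))
        · rintro (rfl | rfl)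
          · exact ⟨⟨hST, hc⟩, hb⟩
          · exact ⟨⟨hST', hc⟩, hb⟩
      rw [this, Finset.sum_pair hne']
      exact hf _ _ _ ⟨hne', hc, hST, hST'⟩
    · intro T S
      simp only [Finset.mem_univ, true_and, Finset.mem_filter, Finset.mem_biUnion]
      exact ⟨fun h => ⟨h, T, h⟩, fun h => h.1⟩
  rw [hzero, add_zero]
  rfl

theorem not_isBoundarySide_of_isInnerSide (hΩ : interior (closure Ω) = Ω) (hd : 0 < d)
    {T T' : Th.elements} {S : Finset (Vec d)} (h : Th.IsInnerSide T T' S) :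
    ¬ Th.IsBoundarySide S := fun hb =>
  h.1 (Subtype.ext (Th.unique_of_isBoundarySide hΩ hd hb T.2 T'.2 h.2.2.1 h.2.2.2))

theorem sum_powersetCard_single (f : Th.elements → Finset (Vec d) → ℝ) {S : Finset (Vec d)}
    (hf : ∀ T S', S' ≠ S → f T S' = 0) (hc : S.card = d) (T : Th.elements) [Decidable (S ⊆ T.1)] :
    ∑ S' ∈ T.1.powersetCard d, f T S' = if S ⊆ T.1 then f T S else 0 := by
  split_ifs with h
  · exact Finset.sum_eq_single_of_mem S (Finset.mem_powersetCard.2 ⟨h, hc⟩) fun S' _ => hf T S'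
  · refine Finset.sum_eq_zero fun S' hS' => hf T S' ?_
    rintro rfl
    exact h (Finset.mem_powersetCard.1 hS').1

/-- Evaluates the side sums for test functions concentrated on one inner side. -/
theorem sum_single_inner (hd : 0 < d) (f : Th.elements → Finset (Vec d) → ℝ)
    {T T' : Th.elements} {S : Finset (Vec d)} (h : Th.IsInnerSide T T' S)
    (hf : ∀ T S', S' ≠ S → f T S' = 0) :
    ∑ T : Th.elements, ∑ S ∈ T.1.powersetCard d, f T S = f T S + f T' S := by
  classical
  rw [Finset.sum_congr rfl fun T _ => Th.sum_powersetCard_single f hf h.2.1 T,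
    ← Finset.sum_filter]
  have : (Finset.univ.filter fun T : Th.elements => S ⊆ T.1) = {T, T'} := by
    ext T''
    simp only [Finset.mem_filter, Finset.mem_univ, true_and, Finset.mem_insert,
      Finset.mem_singleton]
    constructor
    · intro h1
      by_cases hTT : T'' = T
      · exact Or.inl hTT
      · right
        exact Subtype.ext (Th.common_side_at_most_two hd h.2.1 T.2 T'.2 T''.2 h.2.2.1 h.2.2.2 h1
          (fun h' => h.1 (Subtype.ext h')) fun h => hTT (Subtype.ext h))
    · rintro (rfl | rfl)
      · exact h.2.2.1
      · exact h.2.2.2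
  rw [this, Finset.sum_pair h.1]

theorem sum_single_boundary (hΩ : interior (closure Ω) = Ω) (hd : 0 < d)
    (f : Th.elements → Finset (Vec d) → ℝ)
    {T : Th.elements} {S : Finset (Vec d)} (h : Th.IsBoundarySide S) (hST : S ⊆ T.1)
    (hf : ∀ T S', S' ≠ S → f T S' = 0) :
    ∑ T : Th.elements, ∑ S ∈ T.1.powersetCard d, f T S = f T S := by
  classical
  rw [Finset.sum_congr rfl fun T _ => Th.sum_powersetCard_single f hf h.1 T,
    Finset.sum_eq_single_of_mem T (Finset.mem_univ _), if_pos hST]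
  intro T' _ hne
  rw [if_neg]
  exact fun h' => hne (Subtype.ext (Th.unique_of_isBoundarySide hΩ hd h T'.2 T.2 h' hST))

theorem sumSides_eq_zero (γ : Set (Vec d)) (f : Th.elements → Finset (Vec d) → ℝ)
    (hf : ∀ T : Th.elements, ∀ S ⊆ T.1, Th.IsSideOn γ S → f T S = 0) : Th.sumSides γ f = 0 := by
  classical
  refine Finset.sum_eq_zero fun T _ => Finset.sum_eq_zero fun S hS => ?_
  obtain ⟨h1, h2⟩ := Finset.mem_filter.1 hS
  exact hf T S (Finset.mem_powersetCard.1 h1).1 h2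

theorem sumSides_congr (γ : Set (Vec d)) {f g : Th.elements → Finset (Vec d) → ℝ}
    (hfg : ∀ T : Th.elements, ∀ S ⊆ T.1, Th.IsSideOn γ S → f T S = g T S) :
    Th.sumSides γ f = Th.sumSides γ g := by
  classical
  refine Finset.sum_congr rfl fun T _ => Finset.sum_congr rfl fun S hS => ?_
  obtain ⟨h1, h2⟩ := Finset.mem_filter.1 hS
  exact hfg T S (Finset.mem_powersetCard.1 h1).1 h2

theorem sumSides_single (hΩ : interior (closure Ω) = Ω) (hd : 0 < d)
    {γ : Set (Vec d)} (f : Th.elements → Finset (Vec d) → ℝ)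
    {T : Th.elements} {S : Finset (Vec d)} (h : Th.IsSideOn γ S) (hST : S ⊆ T.1)
    (hf : ∀ T S', S' ≠ S → f T S' = 0) : Th.sumSides γ f = f T S := by
  classical
  rw [← Th.sum_single_boundary hΩ hd f h.1 hST hf]
  refine Finset.sum_congr rfl fun T _ => ?_
  refine Finset.sum_subset (Finset.filter_subset _ _) fun S' h1 h2 => hf T S' ?_
  rintro rfl
  exact h2 (Finset.mem_filter.2 ⟨h1, h⟩)

end Triangulation

/-! ### Convex analysis and integrals of extended-real-valued constants -/

open Filter Topology

section Convex

variable {F : Type*} [NormedAddCommGroup F] [InnerProductSpace ℝ F]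

theorem le_conj (f : F → EReal) (s r : F) :
    (((inner ℝ s r : ℝ) : EReal) - f r) ≤ conj f s :=
  le_iSup (fun r => ((inner ℝ s r : ℝ) : EReal) - f r) r

theorem ProperFun.conj_ne_bot {f : F → EReal} (hf : ProperFun f) (s : F) : conj f s ≠ ⊥ := by
  obtain ⟨hb, r, hr⟩ := hf
  intro h
  have := le_conj f s r
  rw [h, le_bot_iff] at this
  lift f r to ℝ using ⟨hr, hb r⟩ with a
  rw [← EReal.coe_sub] at this
  exact EReal.coe_ne_bot _ this

/-- The Fenchel--Young inequality for finite values. -/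
theorem inner_le_of_conj_eq {f : F → EReal} {s r : F} {a b : ℝ} (hr : f r = a) (hs : conj f s = b) :
    inner ℝ s r ≤ a + b := by
  have := le_conj f s r
  rw [hr, hs, ← EReal.coe_sub, EReal.coe_le_coe_iff] at this
  linarith

/-- The epigraph is an intersection over `r` of half-spaces. The values `f r = ⊥` and `f r = ⊤`
contribute the empty set and the whole space. -/
theorem convexFun_conj (f : F → EReal) : ConvexFun (conj f) := by
  have : {p : F × ℝ | conj f p.1 ≤ (p.2 : EReal)}
      = ⋂ r, {p : F × ℝ | ((inner ℝ p.1 r : ℝ) : EReal) - f r ≤ (p.2 : EReal)} := by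
    ext p
    simp [conj, iSup_le_iff]
  rw [ConvexFun, this]
  refine convex_iInter fun r => ?_
  induction f r with
  | bot => simpa using convex_empty
  | top => simpa using convex_univ
  | coe a =>
    intro p hp q hq s t hs ht hst
    simp only [Set.mem_ofPred_eq, ← EReal.coe_sub, EReal.coe_le_coe_iff] at hp hq ⊢
    simp only [Prod.fst_add, Prod.smul_fst, inner_add_left, real_inner_smul_left, Prod.snd_add,
      Prod.smul_snd, smul_eq_mul]
    have h1 := mul_le_mul_of_nonneg_left hp hs
    have h2 := mul_le_mul_of_nonneg_left hq ht
    have h3 : s * a + t * a = a := by rw [← add_mul, hst, one_mul]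
    linarith

theorem ConvexFun.convexOn {f : F → EReal} (hf : ConvexFun f) {g : F → ℝ}
    (hg : ∀ r, f r = (g r : EReal)) : ConvexOn ℝ Set.univ g := by
  refine ⟨convex_univ, fun x _ y _ a b ha hb hab => ?_⟩
  have hx : (x, g x) ∈ {p : F × ℝ | f p.1 ≤ (p.2 : EReal)} := (hg x).le
  have hy : (y, g y) ∈ {p : F × ℝ | f p.1 ≤ (p.2 : EReal)} := (hg y).le
  have := hf hx hy ha hb hab
  simp only [Set.mem_ofPred_eq, hg] at this
  exact EReal.coe_le_coe_iff.1 this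

/-- Restrict to the line from `r` to `q`, where the derivative at `0` is at most the secant slope to
`1`. -/
theorem convexOn_add_inner_gradient_le [CompleteSpace F] {g : F → ℝ} (hg : ConvexOn ℝ Set.univ g)
    {r n : F} (hn : HasGradientAt g n r) (q : F) : g r + inner ℝ n (q - r) ≤ g q := by
  have hc : ConvexOn ℝ Set.univ (g ∘ (AffineMap.lineMap (k := ℝ) r q)) := by
    have := hg.comp_affineMap (AffineMap.lineMap (k := ℝ) r q)
    simpa using this
  have hd : HasDerivAt (g ∘ (AffineMap.lineMap (k := ℝ) r q)) (inner ℝ n (q - r)) 0 := by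
    have h1 : HasDerivAt (AffineMap.lineMap (k := ℝ) r q) (q - r) 0 := AffineMap.hasDerivAt_lineMap
    have h2 := hn.hasFDerivAt
    rw [← AffineMap.lineMap_apply_zero (k := ℝ) r q] at h2
    have := h2.comp_hasDerivAt 0 h1
    simpa using this
  have := hc.le_slope_of_hasDerivAt (Set.mem_univ 0) (Set.mem_univ 1) zero_lt_one hd
  simp [slope] at this
  linarith

theorem IsC1.exists_hasGradientAt [CompleteSpace F] {f : F → EReal} (hf : IsC1 f) :
    ∃ g : F → ℝ, (∀ r, f r = (g r : EReal)) ∧ ∀ r, HasGradientAt g (D f r) r := by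
  obtain ⟨g, hg, hfg⟩ := hf
  refine ⟨g, hfg, fun r => ?_⟩
  have : (fun q => (f q).toReal) = g := by
    ext q; rw [hfg, EReal.toReal_coe]
  rw [D, this]
  exact (hg.differentiable one_ne_zero r).hasGradientAt

/-- Equality in the Fenchel--Young inequality at the gradient. -/
theorem conj_gradient [CompleteSpace F] {f : F → EReal} (hc : ConvexFun f) {g : F → ℝ}
    (hfg : ∀ r, f r = (g r : EReal)) {r n : F} (hn : HasGradientAt g n r) :
    conj f n = ((inner ℝ n r - g r : ℝ) : EReal) := by
  apply le_antisymm
  · refine iSup_le fun q => ?_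
    rw [hfg, ← EReal.coe_sub, EReal.coe_le_coe_iff]
    have := convexOn_add_inner_gradient_le (hc.convexOn hfg) hn q
    rw [inner_sub_right] at this
    linarith
  · have := le_conj f n r
    rwa [hfg, ← EReal.coe_sub] at this

/-- The Fenchel--Moreau theorem for functions with finite conjugate. -/
theorem le_of_forall_conj [CompleteSpace F] {f : F → EReal} (hp : ProperFun f) (hc : ConvexFun f)
    (hl : LowerSemicontinuous f) {G : F → ℝ} (hG : ∀ s, conj f s = (G s : EReal)) {r : F} {c : ℝ}
    (h : ∀ s, inner ℝ s r - G s ≤ c) : f r ≤ c := by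
  by_contra hlt
  have hclosed : IsClosed {p : F × ℝ | f p.1 ≤ (p.2 : EReal)} :=
    hl.isClosed_epigraph.preimage
      (continuous_fst.prodMk (continuous_coe_real_ereal.comp continuous_snd))
  -- If `f r > c`, a hyperplane strictly separates `(r, c)` from the closed convex epigraph; `w` and
  -- `β` are its horizontal and vertical coefficients.
  obtain ⟨φ, u, h1, h2⟩ := geometric_hahn_banach_point_closed (x := (r, c)) hc hclosed hlt
  let w : F := (InnerProductSpace.toDual ℝ F).symm (φ.comp (ContinuousLinearMap.inl ℝ F ℝ))
  set β : ℝ := φ (0, 1) with hβ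
  have hφ : ∀ x a, φ (x, a) = inner ℝ w x + a * β := by
    intro x a
    have e1 : inner ℝ w x = φ (x, 0) := by simp [w]
    have e2 : a * β = φ (0, a) := by
      rw [hβ, ← smul_eq_mul, ← map_smul]; simp
    rw [e1, e2, ← map_add]; simp
  rw [hφ] at h1
  have h2' : ∀ x (a : ℝ), f x ≤ a → u < inner ℝ w x + a * β := fun x a hx => by
    rw [← hφ]; exact h2 (x, a) hx
  obtain ⟨x₀, hx₀⟩ := hp.2
  -- The epigraph is unbounded upwards over a point of the domain, which excludes a negative
  -- vertical coefficient.
  have hβ0 : 0 ≤ β := by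
    by_contra hneg
    push Not at hneg
    obtain ⟨a₀, ha₀⟩ : ∃ a₀ : ℝ, f x₀ = a₀ := by
      lift f x₀ to ℝ using ⟨hx₀, hp.1 x₀⟩ with a
      exact ⟨a, rfl⟩
    set a := max a₀ ((u - inner ℝ w x₀) / β) with ha
    have := h2' x₀ a (by rw [ha₀]; exact EReal.coe_le_coe_iff.2 (le_max_left _ _))
    have h3 : (u - inner ℝ w x₀) / β ≤ a := le_max_right _ _
    rw [div_le_iff_of_neg hneg] at h3
    linarith
  have hub : ∀ s (b : ℝ), (∀ x (a : ℝ), f x = a → inner ℝ s x - a ≤ b) → G s ≤ b := by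
    intro s b hb
    rw [← EReal.coe_le_coe_iff, ← hG]
    refine iSup_le fun x => ?_
    by_cases hx : f x = ⊤
    · rw [hx]; simp
    · obtain ⟨a, ha⟩ : ∃ a : ℝ, f x = a := by
        lift f x to ℝ using ⟨hx, hp.1 x⟩ with a
        exact ⟨a, rfl⟩
      rw [ha, ← EReal.coe_sub, EReal.coe_le_coe_iff]
      exact hb x a ha
  rcases hβ0.lt_or_eq with hpos | hzero
  -- A non-vertical hyperplane is the graph of an affine minorant of `f` with slope `-β⁻¹ w`, and
  -- this slope contradicts `h`.
  · have hs := hub ((-β⁻¹) • w) (-u / β) fun x a ha => by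
      have := h2' x a ha.le
      rw [real_inner_smul_left, le_div_iff₀ hpos]
      field_simp
      linarith
    have := h ((-β⁻¹) • w)
    rw [real_inner_smul_left] at this
    have h3 : -β⁻¹ * inner ℝ w r - -u / β ≤ c := by linarith
    have h4 : (u - inner ℝ w r) / β ≤ c := by
      calc (u - inner ℝ w r) / β = -β⁻¹ * inner ℝ w r - -u / β := by field_simp; ring
        _ ≤ c := h3
    rw [div_le_iff₀ hpos] at h4
    linarith
  · rw [← hzero] at h1 h2'
    simp only [mul_zero, add_zero] at h1 h2'
    -- A vertical hyperplane gives no minorant by itself; tilting the bound by `G 0` with multiples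
    -- of `-w` makes `⟨s, r⟩ - G s` unbounded, so `h` still fails.
    have hs : ∀ n : ℕ, G (-((n : ℝ) • w)) ≤ G 0 - n * u := fun n => hub _ _ fun x a ha => by
      have := h2' x a ha.le
      have hy := inner_le_of_conj_eq ha (hG 0)
      rw [inner_zero_left] at hy
      rw [inner_neg_left, real_inner_smul_left]
      have hn : (0 : ℝ) ≤ n := n.cast_nonneg
      nlinarith
    have hpos : 0 < u - inner ℝ w r := sub_pos.2 h1
    obtain ⟨n, hn⟩ := exists_nat_gt ((c + G 0) / (u - inner ℝ w r))
    rw [div_lt_iff₀ hpos] at hn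
    have := h (-((n : ℝ) • w))
    rw [inner_neg_left, real_inner_smul_left] at this
    have := hs n
    linarith

/-- Equality in the Fenchel--Young inequality at the gradient of the conjugate. -/
theorem apply_gradient_conj [CompleteSpace F] {f : F → EReal} (hp : ProperFun f)
    (hc : ConvexFun f) (hl : LowerSemicontinuous f) {G : F → ℝ}
    (hG : ∀ s, conj f s = (G s : EReal)) {s n : F} (hn : HasGradientAt G n s) :
    f n = ((inner ℝ s n - G s : ℝ) : EReal) := by
  apply le_antisymm
  -- The bound required for all slopes `t` is the gradient inequality for the convex function `G` at
  -- `s`.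
  · refine le_of_forall_conj hp hc hl hG fun t => ?_
    have := convexOn_add_inner_gradient_le ((convexFun_conj f).convexOn hG) hn t
    rw [inner_sub_right, real_inner_comm, real_inner_comm s n] at this
    linarith
  · by_cases hn' : f n = ⊤
    · rw [hn']; exact le_top
    · obtain ⟨a, ha⟩ : ∃ a : ℝ, f n = a := by
        lift f n to ℝ using ⟨hn', hp.1 n⟩ with a
        exact ⟨a, rfl⟩
      have := inner_le_of_conj_eq ha (hG s)
      rw [ha, EReal.coe_le_coe_iff]
      linarith

end Convex

section Integral

variable {X : Type*} [MeasurableSpace X] {μ : Measure X} {f : X → EReal}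

theorem eintegral_congr {g : X → EReal} (h : f =ᵐ[μ] g) : eintegral μ f = eintegral μ g := by
  have h1 : ∫⁻ x, (f x).toENNReal ∂μ = ∫⁻ x, (g x).toENNReal ∂μ :=
    lintegral_congr_ae (h.fun_comp EReal.toENNReal)
  have h2 : ∫⁻ x, (-f x).toENNReal ∂μ = ∫⁻ x, (-g x).toENNReal ∂μ :=
    lintegral_congr_ae (h.fun_comp fun y => (-y).toENNReal)
  rw [eintegral, eintegral, h1, h2]

theorem eintegral_coe [IsFiniteMeasure μ] {c : ℝ} (h : ∀ᵐ x ∂μ, f x = c) :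
    eintegral μ f = ((μ.real Set.univ * c : ℝ) : EReal) := by
  rw [eintegral_congr (g := fun _ => (c : EReal)) h, eintegral, lintegral_const, lintegral_const,
    ← EReal.coe_neg, EReal.real_coe_toENNReal, EReal.real_coe_toENNReal,
    ← ENNReal.ofReal_toReal (measure_ne_top μ Set.univ),
    ← ENNReal.ofReal_mul' ENNReal.toReal_nonneg, ← ENNReal.ofReal_mul' ENNReal.toReal_nonneg,
    EReal.coe_ennreal_ofReal, EReal.coe_ennreal_ofReal, ← EReal.coe_sub, Measure.real]
  congr 1
  rw [neg_mul, mul_comm]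
  rcases le_total 0 ((μ Set.univ).toReal * c) with h | h
  · rw [max_eq_left h, max_eq_right (by linarith)]; ring
  · rw [max_eq_right h, max_eq_left (by linarith)]; ring

/-- Positive measure is essential, since `⊤ * 0 = 0`. -/
theorem eintegral_top (hμ : μ Set.univ ≠ 0) (h : ∀ᵐ x ∂μ, f x = ⊤) : eintegral μ f = ⊤ := by
  rw [eintegral_congr (g := fun _ => ⊤) h, eintegral, lintegral_const, lintegral_const]
  simp [ENNReal.top_mul hμ]

end Integral

/-! ### Discrete duality -/

open Filter Topology

theorem sum_ereal_ne_bot {ι : Type*} (s : Finset ι) (f : ι → EReal) (h : ∀ i ∈ s, f i ≠ ⊥) :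
    ∑ i ∈ s, f i ≠ ⊥ := by
  classical
  induction s using Finset.induction_on with
  | empty => simp
  | insert a s ha ih =>
    rw [Finset.sum_insert ha, Ne, EReal.add_eq_bot_iff, not_or]
    exact ⟨h a (Finset.mem_insert_self a s), ih fun i hi => h i (Finset.mem_insert_of_mem hi)⟩

/-- In `EReal`, `⊤ + ⊥ = ⊥`, so a summand `⊤` dominates only in the absence of `⊥`. -/
theorem sum_ereal_eq_top {ι : Type*} (s : Finset ι) (f : ι → EReal) (h : ∀ i ∈ s, f i ≠ ⊥)
    {i : ι} (hi : i ∈ s) (hf : f i = ⊤) : ∑ i ∈ s, f i = ⊤ := by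
  classical
  rw [← Finset.add_sum_erase _ _ hi, hf]
  exact EReal.top_add_of_ne_bot
    (sum_ereal_ne_bot _ _ fun j hj => h j (Finset.mem_of_mem_erase hj))

theorem coe_sum_ereal {ι : Type*} (s : Finset ι) (f : ι → ℝ) :
    ∑ i ∈ s, ((f i : ℝ) : EReal) = ((∑ i ∈ s, f i : ℝ) : EReal) := by
  classical
  induction s using Finset.induction_on with
  | empty => simp
  | insert a s ha ih => rw [Finset.sum_insert ha, Finset.sum_insert ha, ih, EReal.coe_add]

theorem exists_coe_eq {a : EReal} (h1 : a ≠ ⊤) (h2 : a ≠ ⊥) : ∃ r : ℝ, a = r :=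
  ⟨a.toReal, (EReal.coe_toReal h1 h2).symm⟩

/-- The surface measure of a side. -/
def area {d : ℕ} (S : Finset (Vec d)) : ℝ := (μHE[d - 1] : Measure (Vec d)).real (simplex S)

namespace Nondeg

variable {d : ℕ} {T : Finset (Vec d)} (hT : Nondeg T)
include hT

theorem area_pos_of_subset (hd : 0 < d) {S : Finset (Vec d)} (hS : S ⊆ T) (hc : S.card = d) :
    0 < area S := by
  obtain ⟨p, hp, -, rfl⟩ := exists_eq_erase hT.card_eq hS hc
  exact hT.area_pos hd hp

theorem centre_mem_of_subset (hd : 0 < d) {S : Finset (Vec d)} (hS : S ⊆ T) (hc : S.card = d) :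
    centre S ∈ simplex S := by
  obtain ⟨p, hp, -, rfl⟩ := exists_eq_erase hT.card_eq hS hc
  exact hT.centre_mem hd hp

variable {F : Type*} [NormedAddCommGroup F] [NormedSpace ℝ F] [CompleteSpace F]

theorem sideAvg_eq (hd : 0 < d) {S : Finset (Vec d)} (hS : S ⊆ T) (hc : S.card = d)
    (v : Vec d →ᵃ[ℝ] F) : Triangulation.sideAvg S v = (d : ℝ)⁻¹ • ∑ q ∈ S, v q := by
  obtain ⟨p, hp, -, rfl⟩ := exists_eq_erase hT.card_eq hS hc
  exact hT.sideAvg_affine hd hp v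

theorem sideAvg_add_smul (hd : 0 < d) {S : Finset (Vec d)} (hS : S ⊆ T) (hc : S.card = d)
    (v w : Vec d →ᵃ[ℝ] F) (t : ℝ) : Triangulation.sideAvg S (v + t • w)
      = Triangulation.sideAvg S v + t • Triangulation.sideAvg S w := by
  have h := hT.sideAvg_eq hd hS hc (v + t • w)
  rw [h, hT.sideAvg_eq hd hS hc, hT.sideAvg_eq hd hS hc, smul_comm t, ← smul_add,
    Finset.smul_sum (r := t),
    ← Finset.sum_add_distrib]
  rfl

theorem sideAvg_sub (hd : 0 < d) {S : Finset (Vec d)} (hS : S ⊆ T) (hc : S.card = d)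
    (v w : Vec d →ᵃ[ℝ] F) : Triangulation.sideAvg S (fun x => v x - w x)
      = Triangulation.sideAvg S v - Triangulation.sideAvg S w := by
  have h := hT.sideAvg_eq hd hS hc (v - w)
  have e : ⇑(v - w) = fun x => v x - w x := rfl
  rw [e] at h
  rw [h, hT.sideAvg_eq hd hS hc, hT.sideAvg_eq hd hS hc, ← smul_sub, ← Finset.sum_sub_distrib]

theorem elemAvg_add_smul (v w : Vec d →ᵃ[ℝ] F) (t : ℝ) : Triangulation.elemAvg T (v + t • w)
      = Triangulation.elemAvg T v + t • Triangulation.elemAvg T w := by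
  have h := hT.elemAvg_affine (v + t • w)
  rw [h, hT.elemAvg_affine, hT.elemAvg_affine, smul_comm t, ← smul_add,
    Finset.smul_sum (r := t),
    ← Finset.sum_add_distrib]
  rfl

end Nondeg

theorem div_add_smul {d l : ℕ} (v w : Vec d →ᵃ[ℝ] Mat l d) (t : ℝ) :
    Triangulation.div (v + t • w) = Triangulation.div v + t • Triangulation.div w := by
  ext i
  simp [Triangulation.div, Finset.sum_add_distrib, Finset.mul_sum]

theorem hasDerivAt_sum_comp {ι F : Type*} [Fintype ι] [NormedAddCommGroup F]
    [InnerProductSpace ℝ F] [CompleteSpace F] (m : ι → ℝ) {g : ι → F → ℝ} {p n : ι → F}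
    (h : ∀ i, HasGradientAt (g i) (n i) (p i)) (q : ι → F) :
    HasDerivAt (fun t : ℝ => ∑ i, m i * g i (p i + t • q i)) (∑ i, m i * inner ℝ (n i) (q i)) 0 := by
  refine HasDerivAt.fun_sum fun i _ => HasDerivAt.const_mul _ ?_
  have h1 : HasDerivAt (fun t : ℝ => p i + t • q i) (q i) 0 := by
    simpa using ((hasDerivAt_id (0 : ℝ)).smul_const (q i)).const_add (p i)
  have h2 := (h i).hasFDerivAt
  have e : p i = p i + (0 : ℝ) • q i := by simp
  rw [e] at h2
  simpa [Function.comp_def] using h2.comp_hasDerivAt (0 : ℝ) h1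

namespace Triangulation

variable {d l : ℕ} {Ω : Set (Vec d)} (Th : Triangulation Ω)

/-- The normal component of `y` on the side `S` of `T`. -/
def trace (y : Th.Broken (Mat l d)) (T : Th.elements) (S : Finset (Vec d)) : Vec l :=
  matVec (y T (centre S)) (outerNormal T.1 S)

/-- The normal components of `y` on the sides of the elements are constant. -/
def NormalConst (y : Th.Broken (Mat l d)) : Prop :=
  ∀ T : Th.elements, ∀ S ∈ T.1.powersetCard d, ∀ x ∈ simplex S, ∀ x' ∈ simplex S,
    matVec (y T x) (outerNormal T.1 S) = matVec (y T x') (outerNormal T.1 S)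

variable {Th}

theorem NormalConst.eq_trace {y : Th.Broken (Mat l d)} (hy : Th.NormalConst y) (hd : 0 < d)
    {T : Th.elements} {S : Finset (Vec d)} (hS : S ⊆ T.1) (hc : S.card = d) {x : Vec d}
    (hx : x ∈ simplex S) : matVec (y T x) (outerNormal T.1 S) = Th.trace y T S :=
  hy T S (Finset.mem_powersetCard.2 ⟨hS, hc⟩) x hx _
    ((Th.nondeg T.2).centre_mem_of_subset hd hS hc)

/-- No continuity across sides is assumed of `v` or `y`. The reconstructed fields can thus be
inserted before they are known to lie in the conforming spaces. -/
theorem NormalConst.gauss {y : Th.Broken (Mat l d)} (hy : Th.NormalConst y) (hd : 0 < d)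
    (v : Th.Broken (Vec l)) :
    ∑ T : Th.elements, ∑ S ∈ T.1.powersetCard d, area S * inner ℝ (Th.trace y T S) (sideAvg S (v T))
      = ∑ T : Th.elements, volume.real (simplex T.1) * (inner ℝ (elemAvg T.1 (y T)) (grad (v T))
          + inner ℝ (div (y T)) (elemAvg T.1 (v T))) := by
  classical
  refine Finset.sum_congr rfl fun T _ => ?_
  rw [sum_powersetCard_erase (Th.card_eq T.1 T.2)]
  have nT := Th.nondeg T.2
  exact nT.gauss hd (v T) (y T) (fun p => Th.trace y T (T.1.erase p)) fun p hp x hx =>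
    hy.eq_trace hd (Finset.erase_subset _ _) (nT.card_erase hp) hx

theorem mem_RT_iff (hd : 0 < d) {y : Th.Broken (Mat l d)} : y ∈ Th.RT l ↔ Th.NormalConst y ∧
    ∀ T T' S, Th.IsInnerSide T T' S → Th.trace y T S + Th.trace y T' S = 0 := by
  constructor
  · rintro ⟨h1, h2⟩
    exact ⟨h1, fun T T' S h => h2 T T' S h _
      ((Th.nondeg T.2).centre_mem_of_subset hd h.2.2.1 h.2.1)⟩
  · rintro ⟨h1, h2⟩
    refine ⟨h1, fun T T' S h x hx => ?_⟩
    rw [h1.eq_trace hd h.2.2.1 h.2.1 hx, h1.eq_trace hd h.2.2.2 h.2.1 hx, h2 T T' S h]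

theorem mem_CR_iff (hd : 0 < d) {v : Th.Broken (Vec l)} : v ∈ Th.CR l ↔
    ∀ T T' S, Th.IsInnerSide T T' S → sideAvg S (v T) = sideAvg S (v T') := by
  refine forall₄_congr fun T T' S h => ?_
  rw [(Th.nondeg T.2).sideAvg_sub hd h.2.2.1 h.2.1, sub_eq_zero]

/-! ### Free choice of side means and normal components -/

variable (Th)

theorem exists_broken_sideAvg (hd : 0 < d) (α : Finset (Vec d) → Vec l) :
    ∃ v : Th.Broken (Vec l), ∀ T : Th.elements, ∀ S ⊆ T.1, S.card = d →
      sideAvg S (v T) = α S := by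
  classical
  choose v hv using fun T : Th.elements => (Th.nondeg T.2).exists_sideAvg_eq hd α
  refine ⟨v, fun T S hS hc => ?_⟩
  obtain ⟨p, hp, -, rfl⟩ := exists_eq_erase (Th.card_eq T.1 T.2) hS hc
  exact hv T p hp

theorem exists_CR (hd : 0 < d) (α : Finset (Vec d) → Vec l) :
    ∃ v ∈ Th.CR l, ∀ T : Th.elements, ∀ S ⊆ T.1, S.card = d → sideAvg S (v T) = α S := by
  obtain ⟨v, hv⟩ := Th.exists_broken_sideAvg hd α
  refine ⟨v, (mem_CR_iff hd).2 fun T T' S h => ?_, hv⟩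
  rw [hv T S h.2.2.1 h.2.1, hv T' S h.2.2.2 h.2.1]

/-- Normal components on the sides of one element are independent, so the only compatibility
condition is cancellation on inner sides. -/
theorem exists_RT (hd : 0 < d) (β : Th.elements → Finset (Vec d) → Vec l)
    (hβ : ∀ T T' S, Th.IsInnerSide T T' S → β T S + β T' S = 0) :
    ∃ y ∈ Th.RT l, ∀ T : Th.elements, ∀ S ⊆ T.1, S.card = d → Th.trace y T S = β T S := by
  classical
  choose y hy using fun T : Th.elements => (Th.nondeg T.2).exists_normal_eq hd (β T)
  have hy' : ∀ T : Th.elements, ∀ S ⊆ T.1, S.card = d → ∀ x ∈ simplex S,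
      matVec (y T x) (outerNormal T.1 S) = β T S := by
    intro T S hS hc x hx
    obtain ⟨p, hp, -, rfl⟩ := exists_eq_erase (Th.card_eq T.1 T.2) hS hc
    exact hy T p hp x hx
  refine ⟨y, ⟨fun T S hS x hx x' hx' => ?_, fun T T' S h x hx => ?_⟩, fun T S hS hc => ?_⟩
  · obtain ⟨h1, h2⟩ := Finset.mem_powersetCard.1 hS
    rw [hy' T S h1 h2 x hx, hy' T S h1 h2 x' hx']
  · rw [hy' T S h.2.2.1 h.2.1 x hx, hy' T' S h.2.2.2 h.2.1 x hx, hβ T T' S h]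
  · exact hy' T S hS hc _ ((Th.nondeg T.2).centre_mem_of_subset hd hS hc)

variable {Th}

theorem CR_add_smul (hd : 0 < d) {v w : Th.Broken (Vec l)} (hv : v ∈ Th.CR l) (hw : w ∈ Th.CR l)
    (t : ℝ) : (fun T => v T + t • w T) ∈ Th.CR l := by
  rw [mem_CR_iff hd] at *
  intro T T' S h
  rw [(Th.nondeg T.2).sideAvg_add_smul hd h.2.2.1 h.2.1,
    (Th.nondeg T'.2).sideAvg_add_smul hd h.2.2.2 h.2.1, hv T T' S h, hw T T' S h]

theorem trace_add_smul (v w : Th.Broken (Mat l d)) (t : ℝ) (T : Th.elements)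
    (S : Finset (Vec d)) : Th.trace (fun T => v T + t • w T) T S
      = Th.trace v T S + t • Th.trace w T S := by
  rw [trace, trace, trace, ← matVec_smul, ← matVec_add]
  rfl

theorem RT_add_smul (hd : 0 < d) {y w : Th.Broken (Mat l d)} (hy : y ∈ Th.RT l)
    (hw : w ∈ Th.RT l) (t : ℝ) : (fun T => y T + t • w T) ∈ Th.RT l := by
  rw [mem_RT_iff hd] at *
  refine ⟨fun T S hS x hx x' hx' => ?_, fun T T' S h => ?_⟩
  · have e : ∀ x, (y T + t • w T) x = y T x + t • w T x := fun x => rfl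
    simp only [e, matVec_add, matVec_smul, hy.1 T S hS x hx x' hx', hw.1 T S hS x hx x' hx']
  · rw [trace_add_smul, trace_add_smul]
    have h1 := hy.2 T T' S h
    have h2 := hw.2 T T' S h
    calc _ = (Th.trace y T S + Th.trace y T' S) + t • (Th.trace w T S + Th.trace w T' S) := by
          module
      _ = 0 := by rw [h1, h2]; simp

/-- The global integration by parts formula. -/
theorem gauss_CR_RT (hΩ : interior (closure Ω) = Ω) (hd : 0 < d) {ΓD ΓN : Set (Vec d)}
    (hΓ : Th.IsBoundaryPartition ΓD ΓN) {v : Th.Broken (Vec l)} (hv : v ∈ Th.CR l)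
    {y : Th.Broken (Mat l d)} (hy : y ∈ Th.RT l) :
    ∑ T : Th.elements, volume.real (simplex T.1) * (inner ℝ (elemAvg T.1 (y T)) (grad (v T))
          + inner ℝ (div (y T)) (elemAvg T.1 (v T)))
      = Th.sumSides ΓD (fun T S => area S * inner ℝ (Th.trace y T S) (sideAvg S (v T)))
        + Th.sumSides ΓN (fun T S => area S * inner ℝ (Th.trace y T S) (sideAvg S (v T))) := by
  rw [mem_RT_iff hd] at hy
  rw [mem_CR_iff hd] at hv
  rw [← hy.1.gauss hd v, Th.sum_sides hΩ hd hΓ]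
  intro T T' S h
  rw [hv T T' S h, ← mul_add, ← inner_add_left, hy.2 T T' S h, inner_zero_left, mul_zero]

/-- The integrands `φ(x,·)` on the elements. -/
def IsRep {F : Type*} (Th : Triangulation Ω) (f : Vec d → F → EReal)
    (fT : Th.elements → F → EReal) : Prop :=
  ∀ T : Th.elements, ∀ᵐ x ∂(volume.restrict (simplex T.1)), f x = fT T

/-- Each element has positive volume, so almost-everywhere properties hold at some point where the
integrand equals its element-wise constant representative. The parameter `P` carries the smoothness
assumption along. -/
theorem IsIntegrand.exists_isRep {F : Type*} [NormedAddCommGroup F] [InnerProductSpace ℝ F]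
    (hΩ : interior (closure Ω) = Ω) {f : Vec d → F → EReal} (hf : Th.IsIntegrand f)
    {P : (F → EReal) → Prop} (hP : ∀ᵐ x ∂(volume.restrict Ω), P (f x)) :
    ∃ fT, IsRep Th f fT ∧ ∀ T, ProperFun (fT T) ∧ ConvexFun (fT T) ∧
      LowerSemicontinuous (fT T) ∧ P (fT T) := by
  have h : ∀ T : Th.elements, ∃ c : F → EReal,
      (∀ᵐ x ∂(volume.restrict (simplex T.1)), f x = c) ∧ ProperFun c ∧ ConvexFun c ∧
        LowerSemicontinuous c ∧ P c := by
    intro T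
    obtain ⟨c, hc⟩ := hf.2 T.1 T.2
    have hc' : ∀ᵐ x ∂(volume.restrict (simplex T.1)), f x = c := by
      filter_upwards [hc] with x hx using funext hx
    have hne : (ae (volume.restrict (simplex T.1))).NeBot := by
      rw [ae_neBot, Ne, Measure.restrict_eq_zero]
      exact (Th.nondeg T.2).volume_ne_zero
    obtain ⟨x, hx, h1, h2⟩ := (hc'.and ((Th.ae_simplex hΩ T.2 hf.1).and
      (Th.ae_simplex hΩ T.2 hP))).exists
    rw [hx] at h1 h2
    exact ⟨c, hc', h1.1, h1.2.1, h1.2.2, h2⟩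
  choose fT h1 h2 using h
  exact ⟨fT, h1, h2⟩

theorem IsRep.conj {F : Type*} [NormedAddCommGroup F] [InnerProductSpace ℝ F]
    {f : Vec d → F → EReal} {fT : Th.elements → F → EReal} (h : IsRep Th f fT) :
    IsRep Th (fun x => conj (f x)) (fun T => DiscreteDuality.conj (fT T)) := fun T => by
  filter_upwards [h T] with x hx
  rw [hx]

/-! ### Sums of element integrals in the extended reals -/

section Sums

variable {F : Type*} {f : Vec d → F → EReal} {fT : Th.elements → F → EReal}

theorem IsRep.eintegral_coe (h : IsRep Th f fT) {T : Th.elements} {r : F} {a : ℝ}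
    (ha : fT T r = a) : eintegral (volume.restrict (simplex T.1)) (fun x => f x r)
      = ((volume.real (simplex T.1) * a : ℝ) : EReal) := by
  have : IsFiniteMeasure (volume.restrict (simplex T.1)) :=
    ⟨by simpa using (isCompact_simplex T.1).measure_lt_top⟩
  rw [DiscreteDuality.eintegral_coe (c := a), measureReal_restrict_apply_univ]
  filter_upwards [h T] with x hx
  rw [hx, ha]

theorem IsRep.eintegral_top (h : IsRep Th f fT) {T : Th.elements} {r : F}
    (ha : fT T r = ⊤) : eintegral (volume.restrict (simplex T.1)) (fun x => f x r) = ⊤ := by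
  refine DiscreteDuality.eintegral_top ?_ ?_
  · simpa using (Th.nondeg T.2).volume_ne_zero
  · filter_upwards [h T] with x hx
    rw [hx, ha]

theorem IsRep.eintegral_ne_bot (h : IsRep Th f fT) {T : Th.elements} {r : F}
    (ha : fT T r ≠ ⊥) : eintegral (volume.restrict (simplex T.1)) (fun x => f x r) ≠ ⊥ := by
  by_cases ht : fT T r = ⊤
  · rw [h.eintegral_top ht]; exact top_ne_bot
  · obtain ⟨a, ha⟩ := exists_coe_eq ht ha
    rw [h.eintegral_coe ha]; exact EReal.coe_ne_bot _

theorem IsRep.sum_coe (h : IsRep Th f fT) {r : Th.elements → F} {a : Th.elements → ℝ}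
    (ha : ∀ T, fT T (r T) = a T) :
    ∑ T : Th.elements, eintegral (volume.restrict (simplex T.1)) (fun x => f x (r T))
      = ((∑ T : Th.elements, volume.real (simplex T.1) * a T : ℝ) : EReal) := by
  rw [← coe_sum_ereal]
  exact Finset.sum_congr rfl fun T _ => h.eintegral_coe (ha T)

theorem IsRep.sum_ne_bot (h : IsRep Th f fT) {r : Th.elements → F}
    (ha : ∀ T, fT T (r T) ≠ ⊥) :
    ∑ T : Th.elements, eintegral (volume.restrict (simplex T.1)) (fun x => f x (r T)) ≠ ⊥ :=
  sum_ereal_ne_bot _ _ fun T _ => h.eintegral_ne_bot (ha T)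

theorem IsRep.exists_of_sum_ne_top (h : IsRep Th f fT) {r : Th.elements → F}
    (ha : ∀ T, fT T (r T) ≠ ⊥)
    (hs : ∑ T : Th.elements, eintegral (volume.restrict (simplex T.1)) (fun x => f x (r T)) ≠ ⊤) :
    ∃ a : Th.elements → ℝ, ∀ T, fT T (r T) = a T := by
  have : ∀ T, ∃ a : ℝ, fT T (r T) = a := fun T => by
    refine exists_coe_eq (fun ht => hs ?_) (ha T)
    exact sum_ereal_eq_top _ _ (fun T _ => h.eintegral_ne_bot (ha T)) (Finset.mem_univ T)
      (h.eintegral_top ht)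
  choose a ha using this
  exact ⟨a, ha⟩

end Sums

/-! ### Finite values of the two functionals and their gap -/

variable {ΓD ΓN : Set (Vec d)} {φ : Vec d → Mat l d → EReal} {ψ : Vec d → Vec l → EReal}
  {φT : Th.elements → Mat l d → EReal} {ψT : Th.elements → Vec l → EReal}
  {gN uD : Finset (Vec d) → Vec l}

/-- The Dirichlet condition. -/
def PrimalFeasible (Th : Triangulation Ω) (ΓD : Set (Vec d)) (uD : Finset (Vec d) → Vec l)
    (v : Th.Broken (Vec l)) : Prop :=
  ∀ T : Th.elements, ∀ S ⊆ T.1, Th.IsSideOn ΓD S → sideAvg S (v T) = uD S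

theorem primalFeasible_iff {v : Th.Broken (Vec l)} : Th.PrimalFeasible ΓD uD v ↔
    ∀ T : Th.elements, ∀ S ⊆ T.1, Th.IsSideOn ΓD S → sideAvg S (v T) = uD S := Iff.rfl

/-- The Neumann condition. -/
def DualFeasible (Th : Triangulation Ω) (ΓN : Set (Vec d)) (gN : Finset (Vec d) → Vec l)
    (y : Th.Broken (Mat l d)) : Prop :=
  ∀ T : Th.elements, ∀ S ⊆ T.1, Th.IsSideOn ΓN S → Th.trace y T S = gN S

theorem NormalConst.dualFeasible_iff (hd : 0 < d) {y : Th.Broken (Mat l d)}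
    (hy : Th.NormalConst y) : Th.DualFeasible ΓN gN y ↔ ∀ T : Th.elements, ∀ S ⊆ T.1,
      Th.IsSideOn ΓN S → ∀ x ∈ simplex S, matVec (y T x) (outerNormal T.1 S) = gN S := by
  refine forall₄_congr fun T S hS hN => ?_
  constructor
  · intro h x hx
    rw [hy.eq_trace hd hS hN.1.1 hx, h]
  · intro h
    exact h _ ((Th.nondeg T.2).centre_mem_of_subset hd hS hN.1.1)

theorem neumann_term (v : Th.Broken (Vec l)) :
    Th.sumSides ΓN (fun T S => ∫ _x in simplex S, inner ℝ (gN S) (sideAvg S (v T))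
        ∂(μHE[d - 1] : Measure (Vec d)))
      = Th.sumSides ΓN (fun T S => area S * inner ℝ (gN S) (sideAvg S (v T))) :=
  Th.sumSides_congr _ fun T S _ _ => by rw [setIntegral_const, smul_eq_mul, area]

theorem NormalConst.dirichlet_term (hd : 0 < d) {y : Th.Broken (Mat l d)} (hy : Th.NormalConst y) :
    Th.sumSides ΓD (fun T S => ∫ x in simplex S, inner ℝ (matVec (y T x) (outerNormal T.1 S)) (uD S)
        ∂(μHE[d - 1] : Measure (Vec d)))
      = Th.sumSides ΓD (fun T S => area S * inner ℝ (Th.trace y T S) (uD S)) :=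
  Th.sumSides_congr _ fun T S hS hD => by
    rw [setIntegral_congr_fun (g := fun _ => inner ℝ (Th.trace y T S) (uD S))
      (measurableSet_simplex S) fun x hx => by
        simp only [hy.eq_trace hd hS hD.1.1 hx], setIntegral_const, smul_eq_mul, area]

theorem primal_eq (hφ : IsRep Th φ φT) (hψ : IsRep Th ψ ψT) {v : Th.Broken (Vec l)}
    {a b : Th.elements → ℝ} (ha : ∀ T, φT T (grad (v T)) = a T)
    (hb : ∀ T, ψT T (elemAvg T.1 (v T)) = b T) (hv : Th.PrimalFeasible ΓD uD v) :
    Th.primal ΓD ΓN φ ψ gN uD v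
      = ((∑ T : Th.elements, volume.real (simplex T.1) * a T
        + ∑ T : Th.elements, volume.real (simplex T.1) * b T
        - Th.sumSides ΓN (fun T S => area S * inner ℝ (gN S) (sideAvg S (v T))) : ℝ) : EReal) := by
  rw [primal, if_pos (primalFeasible_iff.1 hv), neumann_term, hφ.sum_coe (r := fun T => grad (v T)) ha,
    hψ.sum_coe (r := fun T => elemAvg T.1 (v T)) hb, add_zero, ← EReal.coe_add, ← EReal.coe_sub]

/-- Properness keeps every term away from `⊥`, so no infinite term or violated constraint can be
cancelled in the extended sum. -/
theorem exists_of_primal_ne_top (hφ : IsRep Th φ φT) (hψ : IsRep Th ψ ψT)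
    (pφ : ∀ T, ProperFun (φT T)) (pψ : ∀ T, ProperFun (ψT T)) {v : Th.Broken (Vec l)}
    (h : Th.primal ΓD ΓN φ ψ gN uD v ≠ ⊤) :
    Th.PrimalFeasible ΓD uD v ∧ (∃ a : Th.elements → ℝ, ∀ T, φT T (grad (v T)) = a T) ∧
      ∃ b : Th.elements → ℝ, ∀ T, ψT T (elemAvg T.1 (v T)) = b T := by
  rw [primal] at h
  have hA := hφ.sum_ne_bot (r := fun T => grad (v T)) fun T => (pφ T).1 _
  have hB := hψ.sum_ne_bot (r := fun T => elemAvg T.1 (v T)) fun T => (pψ T).1 _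
  have hA' := hφ.exists_of_sum_ne_top (r := fun T => grad (v T)) fun T => (pφ T).1 _
  have hB' := hψ.exists_of_sum_ne_top (r := fun T => elemAvg T.1 (v T)) fun T => (pψ T).1 _
  set A := ∑ T : Th.elements, eintegral (volume.restrict (simplex T.1)) fun x => φ x (grad (v T))
  set B := ∑ T : Th.elements,
    eintegral (volume.restrict (simplex T.1)) fun x => ψ x (elemAvg T.1 (v T))
  generalize Th.sumSides ΓN _ = s at h
  have hAB : A + B ≠ ⊥ := by rw [Ne, EReal.add_eq_bot_iff, not_or]; exact ⟨hA, hB⟩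
  have hABs : A + B - (s : EReal) ≠ ⊥ := by
    rw [sub_eq_add_neg, ← EReal.coe_neg, Ne, EReal.add_eq_bot_iff, not_or]
    exact ⟨hAB, EReal.coe_ne_bot _⟩
  have hfeas : Th.PrimalFeasible ΓD uD v := by
    by_contra hf
    rw [if_neg (primalFeasible_iff.not.1 hf)] at h
    exact h (EReal.add_top_of_ne_bot hABs)
  rw [if_pos (primalFeasible_iff.1 hfeas), add_zero] at h
  refine ⟨hfeas, hA' fun hA1 => h ?_, hB' fun hB1 => h ?_⟩
  · rw [hA1, EReal.top_add_of_ne_bot hB, EReal.top_sub_coe]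
  · rw [hB1, EReal.add_top_of_ne_bot hA, EReal.top_sub_coe]

theorem dual_eq (hd : 0 < d) (hφ : IsRep Th φ φT) (hψ : IsRep Th ψ ψT) {y : Th.Broken (Mat l d)}
    (hy : Th.NormalConst y)
    {a b : Th.elements → ℝ} (ha : ∀ T, conj (φT T) (elemAvg T.1 (y T)) = a T)
    (hb : ∀ T, conj (ψT T) (div (y T)) = b T) (hf : Th.DualFeasible ΓN gN y) :
    Th.dual ΓD ΓN φ ψ gN uD y
      = ((-∑ T : Th.elements, volume.real (simplex T.1) * a T
        - ∑ T : Th.elements, volume.real (simplex T.1) * b T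
        + Th.sumSides ΓD (fun T S => area S * inner ℝ (Th.trace y T S) (uD S)) : ℝ) : EReal) := by
  rw [dual, if_pos ((hy.dualFeasible_iff hd).1 hf), hy.dirichlet_term hd,
    hφ.conj.sum_coe (r := fun T => elemAvg T.1 (y T)) ha,
    hψ.conj.sum_coe (r := fun T => div (y T)) hb, sub_zero, ← EReal.coe_neg, ← EReal.coe_sub,
    ← EReal.coe_add]

/-- Here `⊥` absorbs every sum, so one bad term suffices; properness is needed only to keep the
conjugates away from `⊥`. -/
theorem exists_of_dual_ne_bot (hd : 0 < d) (hφ : IsRep Th φ φT) (hψ : IsRep Th ψ ψT)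
    (pφ : ∀ T, ProperFun (φT T)) (pψ : ∀ T, ProperFun (ψT T)) {y : Th.Broken (Mat l d)}
    (hy : Th.NormalConst y) (h : Th.dual ΓD ΓN φ ψ gN uD y ≠ ⊥) :
    Th.DualFeasible ΓN gN y ∧
      (∃ a : Th.elements → ℝ, ∀ T, conj (φT T) (elemAvg T.1 (y T)) = a T) ∧
      ∃ b : Th.elements → ℝ, ∀ T, conj (ψT T) (div (y T)) = b T := by
  rw [dual] at h
  have hA' := hφ.conj.exists_of_sum_ne_top (r := fun T => elemAvg T.1 (y T))
    fun T => (pφ T).conj_ne_bot _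
  have hB' := hψ.conj.exists_of_sum_ne_top (r := fun T => div (y T)) fun T => (pψ T).conj_ne_bot _
  set A := ∑ T : Th.elements,
    eintegral (volume.restrict (simplex T.1)) fun x => conj (φ x) (elemAvg T.1 (y T))
  set B := ∑ T : Th.elements,
    eintegral (volume.restrict (simplex T.1)) fun x => conj (ψ x) (div (y T))
  generalize Th.sumSides ΓD _ = s at h
  have hfeas : Th.DualFeasible ΓN gN y := by
    by_contra hf
    rw [hy.dualFeasible_iff hd] at hf
    rw [if_neg hf] at h
    exact h (by rw [sub_eq_add_neg, EReal.neg_top, EReal.add_bot])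
  refine ⟨hfeas, hA' fun hA1 => h ?_, hB' fun hB1 => h ?_⟩
  · rw [hA1, EReal.neg_top, sub_eq_add_neg, sub_eq_add_neg, EReal.bot_add, EReal.bot_add,
      EReal.bot_add]
  · rw [hB1, sub_eq_add_neg, sub_eq_add_neg, EReal.neg_top, EReal.add_bot, EReal.bot_add,
      EReal.bot_add]

/-- The duality gap in terms of the gaps in the Fenchel--Young inequalities. -/
theorem gap_eq (hΩ : interior (closure Ω) = Ω) (hd : 0 < d)
    (hΓ : Th.IsBoundaryPartition ΓD ΓN) {v : Th.Broken (Vec l)} (hv : v ∈ Th.CR l)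
    (hvD : Th.PrimalFeasible ΓD uD v) {y : Th.Broken (Mat l d)} (hy : y ∈ Th.RT l)
    (hyN : Th.DualFeasible ΓN gN y) (a b a' b' : Th.elements → ℝ) :
    (∑ T : Th.elements, volume.real (simplex T.1) * a T
        + ∑ T : Th.elements, volume.real (simplex T.1) * b T
        - Th.sumSides ΓN (fun T S => area S * inner ℝ (gN S) (sideAvg S (v T))))
      - (-∑ T : Th.elements, volume.real (simplex T.1) * a' T
        - ∑ T : Th.elements, volume.real (simplex T.1) * b' T
        + Th.sumSides ΓD (fun T S => area S * inner ℝ (Th.trace y T S) (uD S)))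
      = ∑ T : Th.elements, volume.real (simplex T.1) *
          ((a T + a' T - inner ℝ (elemAvg T.1 (y T)) (grad (v T)))
            + (b T + b' T - inner ℝ (div (y T)) (elemAvg T.1 (v T)))) := by
  have h := gauss_CR_RT hΩ hd hΓ hv hy
  rw [Th.sumSides_congr ΓD (g := fun T S => area S * inner ℝ (Th.trace y T S) (uD S))
      fun T S hS hD => by rw [hvD T S hS hD],
    Th.sumSides_congr ΓN (g := fun T S => area S * inner ℝ (gN S) (sideAvg S (v T)))
      fun T S hS hN => by rw [hyN T S hS hN]] at h
  simp only [mul_add, mul_sub, Finset.sum_add_distrib, Finset.sum_sub_distrib] at h ⊢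
  linarith

/-- Infinite values make the inequality trivial; otherwise the gap is a sum of nonnegative
Fenchel--Young gaps. -/
theorem weak_duality (hΩ : interior (closure Ω) = Ω) (hd : 0 < d)
    (hΓ : Th.IsBoundaryPartition ΓD ΓN) (hφ : IsRep Th φ φT) (hψ : IsRep Th ψ ψT)
    (pφ : ∀ T, ProperFun (φT T)) (pψ : ∀ T, ProperFun (ψT T))
    {v : Th.Broken (Vec l)} (hv : v ∈ Th.CR l) {y : Th.Broken (Mat l d)} (hy : y ∈ Th.RT l) :
    Th.dual ΓD ΓN φ ψ gN uD y ≤ Th.primal ΓD ΓN φ ψ gN uD v := by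
  have hyc := ((mem_RT_iff hd).1 hy).1
  by_cases h1 : Th.primal ΓD ΓN φ ψ gN uD v = ⊤
  · rw [h1]; exact le_top
  by_cases h2 : Th.dual ΓD ΓN φ ψ gN uD y = ⊥
  · rw [h2]; exact bot_le
  obtain ⟨hvD, ⟨a, ha⟩, b, hb⟩ := exists_of_primal_ne_top hφ hψ pφ pψ h1
  obtain ⟨hyN, ⟨a', ha'⟩, b', hb'⟩ := exists_of_dual_ne_bot hd hφ hψ pφ pψ hyc h2
  rw [primal_eq hφ hψ ha hb hvD, dual_eq hd hφ hψ hyc ha' hb' hyN, EReal.coe_le_coe_iff,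
    ← sub_nonneg, gap_eq hΩ hd hΓ hv hvD hy hyN]
  refine Finset.sum_nonneg fun T _ => mul_nonneg measureReal_nonneg ?_
  have e1 := inner_le_of_conj_eq (ha T) (ha' T)
  have e2 := inner_le_of_conj_eq (hb T) (hb' T)
  linarith

/-- Equality in both Fenchel--Young inequalities on each element annihilates every term of the gap.
-/
theorem strong_duality (hΩ : interior (closure Ω) = Ω) (hd : 0 < d)
    (hΓ : Th.IsBoundaryPartition ΓD ΓN) (hφ : IsRep Th φ φT) (hψ : IsRep Th ψ ψT)
    {v : Th.Broken (Vec l)} (hv : v ∈ Th.CR l) (hvD : Th.PrimalFeasible ΓD uD v)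
    {y : Th.Broken (Mat l d)} (hy : y ∈ Th.RT l) (hyN : Th.DualFeasible ΓN gN y)
    {a b a' b' : Th.elements → ℝ} (ha : ∀ T, φT T (grad (v T)) = a T)
    (hb : ∀ T, ψT T (elemAvg T.1 (v T)) = b T)
    (ha' : ∀ T, conj (φT T) (elemAvg T.1 (y T)) = a' T) (hb' : ∀ T, conj (ψT T) (div (y T)) = b' T)
    (hab : ∀ T, a T + a' T = inner ℝ (elemAvg T.1 (y T)) (grad (v T)))
    (hab' : ∀ T, b T + b' T = inner ℝ (div (y T)) (elemAvg T.1 (v T))) :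
    Th.primal ΓD ΓN φ ψ gN uD v = Th.dual ΓD ΓN φ ψ gN uD y := by
  have hyc := ((mem_RT_iff hd).1 hy).1
  rw [primal_eq hφ hψ ha hb hvD, dual_eq hd hφ hψ hyc ha' hb' hyN, EReal.coe_eq_coe_iff,
    ← sub_eq_zero, gap_eq hΩ hd hΓ hv hvD hy hyN]
  refine Finset.sum_eq_zero fun T _ => ?_
  rw [hab, hab', sub_self, sub_self, add_zero, mul_zero]

end Triangulation

/-! ### Optimality conditions -/

open Filter Topology

namespace Triangulation

variable {d l : ℕ} {Ω : Set (Vec d)} {Th : Triangulation Ω}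
  {ΓD ΓN : Set (Vec d)} {φ : Vec d → Mat l d → EReal} {ψ : Vec d → Vec l → EReal}
  {φT : Th.elements → Mat l d → EReal} {ψT : Th.elements → Vec l → EReal}
  {gN uD : Finset (Vec d) → Vec l}

theorem sumSides_add_smul (γ : Set (Vec d)) (f g : Th.elements → Finset (Vec d) → ℝ) (t : ℝ) :
    Th.sumSides γ (fun T S => f T S + t * g T S) = Th.sumSides γ f + t * Th.sumSides γ g := by
  simp only [sumSides, Finset.sum_add_distrib, Finset.mul_sum]

theorem hasDerivAt_const_add_mul (a b : ℝ) : HasDerivAt (fun t : ℝ => a + t * b) b 0 := by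
  simpa using ((hasDerivAt_id (0 : ℝ)).mul_const b).const_add a

/-- The Euler--Lagrange equations of the primal problem. -/
theorem primal_eulerLagrange (hd : 0 < d) (hφ : IsRep Th φ φT) (hψ : IsRep Th ψ ψT)
    {gφ : Th.elements → Mat l d → ℝ} {gψ : Th.elements → Vec l → ℝ}
    (hgφ : ∀ T r, φT T r = (gφ T r : EReal)) (hgψ : ∀ T r, ψT T r = (gψ T r : EReal))
    {A : Th.elements → Mat l d} {B : Th.elements → Vec l} {u : Th.Broken (Vec l)}
    (hA : ∀ T, HasGradientAt (gφ T) (A T) (grad (u T)))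
    (hB : ∀ T, HasGradientAt (gψ T) (B T) (elemAvg T.1 (u T)))
    (hu : u ∈ Th.CR l) (huD : Th.PrimalFeasible ΓD uD u)
    (hmin : IsMinOn (Th.primal ΓD ΓN φ ψ gN uD) (Th.CR l) u)
    {w : Th.Broken (Vec l)} (hw : w ∈ Th.CR l) (hwD : Th.PrimalFeasible ΓD 0 w) :
    ∑ T : Th.elements, volume.real (simplex T.1) * (inner ℝ (A T) (grad (w T))
        + inner ℝ (B T) (elemAvg T.1 (w T)))
      = Th.sumSides ΓN (fun T S => area S * inner ℝ (gN S) (sideAvg S (w T))) := by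
  set m : Th.elements → ℝ := fun T => volume.real (simplex T.1)
  set s₀ := Th.sumSides ΓN (fun T S => area S * inner ℝ (gN S) (sideAvg S (u T)))
  set s := Th.sumSides ΓN (fun T S => area S * inner ℝ (gN S) (sideAvg S (w T)))
  -- The energy along the admissible line `u + t w`, real-valued because the integrands are finite;
  -- its derivative vanishes at the minimum `t = 0`.
  let J : ℝ → ℝ := fun t => ∑ T, m T * gφ T (grad (u T) + t • grad (w T))
    + ∑ T, m T * gψ T (elemAvg T.1 (u T) + t • elemAvg T.1 (w T)) - (s₀ + t * s)
  have hJ : ∀ t, Th.primal ΓD ΓN φ ψ gN uD (fun T => u T + t • w T) = (J t : EReal) := by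
    intro t
    have hfeas : Th.PrimalFeasible ΓD uD (fun T => u T + t • w T) := by
      intro T S hS hD
      rw [(Th.nondeg T.2).sideAvg_add_smul hd hS hD.1.1, huD T S hS hD, hwD T S hS hD,
        Pi.zero_apply, smul_zero, add_zero]
    rw [primal_eq hφ hψ (fun T => hgφ T _) (fun T => hgψ T _) hfeas]
    simp only [J, m, s₀, s]
    rw [← sumSides_add_smul]
    congr 2
    · congr 1
      refine Finset.sum_congr rfl fun T _ => ?_
      rw [(Th.nondeg T.2).elemAvg_add_smul]
    · refine Th.sumSides_congr _ fun T S hS hN => ?_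
      rw [(Th.nondeg T.2).sideAvg_add_smul hd hS hN.1.1, inner_add_right, real_inner_smul_right]
      ring
  have hmin' : IsLocalMin J 0 := by
    refine Eventually.of_forall fun t => ?_
    rw [← EReal.coe_le_coe_iff, ← hJ, ← hJ]
    simp only [zero_smul, add_zero]
    exact hmin (CR_add_smul hd hu hw t)
  have hderiv : HasDerivAt J (∑ T, m T * inner ℝ (A T) (grad (w T))
      + ∑ T, m T * inner ℝ (B T) (elemAvg T.1 (w T)) - s) 0 :=
    ((hasDerivAt_sum_comp m hA _).add (hasDerivAt_sum_comp m hB _)).sub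
      (hasDerivAt_const_add_mul s₀ s)
  have := hmin'.hasDerivAt_eq_zero hderiv
  simp only [mul_add, Finset.sum_add_distrib]
  linarith

/-- The Euler--Lagrange equations of the dual problem. -/
theorem dual_eulerLagrange (hd : 0 < d) (hφ : IsRep Th φ φT) (hψ : IsRep Th ψ ψT)
    {gφ : Th.elements → Mat l d → ℝ} {gψ : Th.elements → Vec l → ℝ}
    (hgφ : ∀ T r, conj (φT T) r = (gφ T r : EReal))
    (hgψ : ∀ T r, conj (ψT T) r = (gψ T r : EReal))
    {A : Th.elements → Mat l d} {B : Th.elements → Vec l} {z : Th.Broken (Mat l d)}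
    (hA : ∀ T, HasGradientAt (gφ T) (A T) (elemAvg T.1 (z T)))
    (hB : ∀ T, HasGradientAt (gψ T) (B T) (div (z T)))
    (hz : z ∈ Th.RT l) (hzN : Th.DualFeasible ΓN gN z)
    (hmax : IsMaxOn (Th.dual ΓD ΓN φ ψ gN uD) (Th.RT l) z)
    {w : Th.Broken (Mat l d)} (hw : w ∈ Th.RT l) (hwN : Th.DualFeasible ΓN 0 w) :
    ∑ T : Th.elements, volume.real (simplex T.1) * (inner ℝ (A T) (elemAvg T.1 (w T))
        + inner ℝ (B T) (div (w T)))
      = Th.sumSides ΓD (fun T S => area S * inner ℝ (Th.trace w T S) (uD S)) := by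
  set m : Th.elements → ℝ := fun T => volume.real (simplex T.1)
  set s₀ := Th.sumSides ΓD (fun T S => area S * inner ℝ (Th.trace z T S) (uD S))
  set s := Th.sumSides ΓD (fun T S => area S * inner ℝ (Th.trace w T S) (uD S))
  let J : ℝ → ℝ := fun t => -∑ T, m T * gφ T (elemAvg T.1 (z T) + t • elemAvg T.1 (w T))
    - ∑ T, m T * gψ T (div (z T) + t • div (w T)) + (s₀ + t * s)
  have hJ : ∀ t, Th.dual ΓD ΓN φ ψ gN uD (fun T => z T + t • w T) = (J t : EReal) := by
    intro t
    have hfeas : Th.DualFeasible ΓN gN (fun T => z T + t • w T) := by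
      intro T S hS hD
      rw [trace_add_smul, hzN T S hS hD, hwN T S hS hD, Pi.zero_apply, smul_zero, add_zero]
    rw [dual_eq hd hφ hψ ((mem_RT_iff hd).1 (RT_add_smul hd hz hw t)).1 (fun T => hgφ T _)
      (fun T => hgψ T _) hfeas]
    simp only [J, m, s₀, s]
    rw [← sumSides_add_smul]
    congr 2
    · congr 2
      · refine Finset.sum_congr rfl fun T _ => ?_
        rw [(Th.nondeg T.2).elemAvg_add_smul]
      · funext T
        rw [div_add_smul]
    · refine Th.sumSides_congr _ fun T S hS hN => ?_
      rw [trace_add_smul, inner_add_left, real_inner_smul_left]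
      ring
  have hmax' : IsLocalMax J 0 := by
    refine Eventually.of_forall fun t => ?_
    rw [← EReal.coe_le_coe_iff, ← hJ, ← hJ]
    simp only [zero_smul, add_zero]
    exact hmax (RT_add_smul hd hz hw t)
  have hderiv : HasDerivAt J (-∑ T, m T * inner ℝ (A T) (elemAvg T.1 (w T))
      - ∑ T, m T * inner ℝ (B T) (div (w T)) + s) 0 :=
    ((hasDerivAt_sum_comp m hA _).neg.sub (hasDerivAt_sum_comp m hB _)).add
      (hasDerivAt_const_add_mul s₀ s)
  have := hmax'.hasDerivAt_eq_zero hderiv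
  simp only [mul_add, Finset.sum_add_distrib]
  linarith

/-- A field with constant normal components that satisfies the weak form of the equilibrium equations
is a Raviart--Thomas field with the prescribed boundary values. -/
theorem mem_RT_of_weak (hΩ : interior (closure Ω) = Ω) (hd : 0 < d)
    (hΓ : Th.IsBoundaryPartition ΓD ΓN) {z : Th.Broken (Mat l d)} (hz : Th.NormalConst z)
    (h : ∀ w ∈ Th.CR l, Th.PrimalFeasible ΓD 0 w →
      ∑ T : Th.elements, ∑ S ∈ T.1.powersetCard d,
        area S * inner ℝ (Th.trace z T S) (sideAvg S (w T))
        = Th.sumSides ΓN (fun T S => area S * inner ℝ (gN S) (sideAvg S (w T)))) :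
    z ∈ Th.RT l ∧ Th.DualFeasible ΓN gN z := by
  classical
  -- Test with the function whose mean is `c` on the side `S` and zero on all others, admissible
  -- since `S` is not a Dirichlet side.
  have key : ∀ (S : Finset (Vec d)) (c : Vec l), ¬ Th.IsSideOn ΓD S →
      ∑ T : Th.elements, ∑ S' ∈ T.1.powersetCard d,
        area S' * inner ℝ (Th.trace z T S') (Pi.single (M := fun _ => Vec l) S c S')
        = Th.sumSides ΓN (fun _ S' =>
            area S' * inner ℝ (gN S') (Pi.single (M := fun _ => Vec l) S c S')) := by
    intro S c hS
    obtain ⟨w, hw, hwα⟩ := Th.exists_CR hd (Pi.single (M := fun _ => Vec l) S c)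
    have hwD : Th.PrimalFeasible ΓD 0 w := by
      intro T S' hS' hD
      rw [hwα T S' hS' hD.1.1, Pi.single_eq_of_ne, Pi.zero_apply]
      rintro rfl
      exact hS hD
    have := h w hw hwD
    rw [Th.sumSides_congr ΓN (g := fun _ S' =>
      area S' * inner ℝ (gN S') (Pi.single (M := fun _ => Vec l) S c S')) fun T S' hS' hN => by
        rw [hwα T S' hS' hN.1.1]] at this
    rw [← this]
    refine Finset.sum_congr rfl fun T _ => Finset.sum_congr rfl fun S' hS' => ?_
    obtain ⟨h1, h2⟩ := Finset.mem_powersetCard.1 hS'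
    rw [hwα T S' h1 h2]
  have hsingle : ∀ (S : Finset (Vec d)) (c : Vec l) (b : Vec l) (S' : Finset (Vec d)), S' ≠ S →
      area S' * inner ℝ b (Pi.single (M := fun _ => Vec l) S c S') = 0 := by
    intro S c b S' hne
    rw [Pi.single_eq_of_ne hne, inner_zero_right, mul_zero]
  constructor
  · refine (mem_RT_iff hd).2 ⟨hz, fun T T' S hS => ?_⟩
    have hb := Th.not_isBoundarySide_of_isInnerSide hΩ hd hS
    -- Choosing the normal jump itself as side mean gives `|S| ‖c‖² = 0`.
    set c := Th.trace z T S + Th.trace z T' S with hc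
    have hk := key S c (fun h => hb h.1)
    rw [Th.sum_single_inner hd _ hS fun T S' hne => hsingle S c _ S' hne,
      Th.sumSides_eq_zero ΓN _ fun T S' hS' hN => hsingle S c _ S' fun h => hb (h ▸ hN.1),
      Pi.single_eq_same, ← mul_add, ← inner_add_left, ← hc] at hk
    have ha := (Th.nondeg T.2).area_pos_of_subset hd hS.2.2.1 hS.2.1
    exact inner_self_eq_zero.1 ((mul_eq_zero.1 hk).resolve_left ha.ne')
  · intro T S hST hN
    set c := Th.trace z T S - gN S with hc
    have hk := key S c fun hD => Th.not_isSideOn_both hΓ hd hD hN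
    rw [Th.sum_single_boundary hΩ hd _ hN.1 hST fun T S' hne => hsingle S c _ S' hne,
      Th.sumSides_single hΩ hd _ hN hST fun T S' hne => hsingle S c _ S' hne,
      Pi.single_eq_same, ← sub_eq_zero, ← mul_sub, ← inner_sub_left, ← hc] at hk
    have ha := (Th.nondeg T.2).area_pos_of_subset hd hST hN.1.1
    exact sub_eq_zero.1 (inner_self_eq_zero.1 ((mul_eq_zero.1 hk).resolve_left ha.ne'))

/-- An element-wise affine function that satisfies the weak form of the compatibility equations is a
Crouzeix--Raviart function with the prescribed boundary values. -/
theorem mem_CR_of_weak (hΩ : interior (closure Ω) = Ω) (hd : 0 < d)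
    (hΓ : Th.IsBoundaryPartition ΓD ΓN) {u : Th.Broken (Vec l)}
    (h : ∀ y ∈ Th.RT l, Th.DualFeasible ΓN 0 y →
      ∑ T : Th.elements, ∑ S ∈ T.1.powersetCard d,
        area S * inner ℝ (Th.trace y T S) (sideAvg S (u T))
        = Th.sumSides ΓD (fun T S => area S * inner ℝ (Th.trace y T S) (uD S))) :
    u ∈ Th.CR l ∧ Th.PrimalFeasible ΓD uD u := by
  classical
  have key : ∀ (β : Th.elements → Finset (Vec d) → Vec l),
      (∀ T T' S, Th.IsInnerSide T T' S → β T S + β T' S = 0) →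
      (∀ T S', Th.IsSideOn ΓN S' → β T S' = 0) →
      ∑ T : Th.elements, ∑ S ∈ T.1.powersetCard d, area S * inner ℝ (β T S) (sideAvg S (u T))
        = Th.sumSides ΓD (fun T S => area S * inner ℝ (β T S) (uD S)) := by
    intro β hβ hβN
    obtain ⟨y, hy, hyβ⟩ := Th.exists_RT hd β hβ
    have := h y hy fun T S' hS' hN => by
      rw [hyβ T S' hS' hN.1.1, hβN T S' hN, Pi.zero_apply]
    rw [Th.sumSides_congr ΓD (g := fun T S => area S * inner ℝ (β T S) (uD S)) fun T S hS hD => by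
        rw [hyβ T S hS hD.1.1]] at this
    rw [← this]
    refine Finset.sum_congr rfl fun T _ => Finset.sum_congr rfl fun S' hS' => ?_
    obtain ⟨h1, h2⟩ := Finset.mem_powersetCard.1 hS'
    rw [hyβ T S' h1 h2]
  constructor
  · refine (mem_CR_iff hd).2 fun T T' S hS => ?_
    have hb := Th.not_isBoundarySide_of_isInnerSide hΩ hd hS
    set c := sideAvg S (u T) - sideAvg S (u T') with hc
    -- Opposite signs on the two neighbours make this the normal trace of a Raviart--Thomas field,
    -- and the tested identity becomes `|S| ‖c‖² = 0`.
    let β : Th.elements → Finset (Vec d) → Vec l := fun T'' S' =>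
      if S' = S then (if T'' = T then c else if T'' = T' then -c else 0) else 0
    have hβT : β T S = c := by simp [β]
    have hβT' : β T' S = -c := by simp [β, hS.1.symm]
    have hβ0 : ∀ T S', S' ≠ S → β T S' = 0 := fun T S' hne => by simp [β, hne]
    have hmem : ∀ T'' : Th.elements, S ⊆ T''.1 → T'' = T ∨ T'' = T' := by
      intro T'' h1
      by_cases hTT : T'' = T
      · exact Or.inl hTT
      · right
        exact Subtype.ext (Th.common_side_at_most_two hd hS.2.1 T.2 T'.2 T''.2 hS.2.2.1 hS.2.2.2 h1
          (fun h' => hS.1 (Subtype.ext h')) fun h => hTT (Subtype.ext h))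
    have hβ : ∀ T T' S, Th.IsInnerSide T T' S → β T S + β T' S = 0 := by
      intro T₁ T₂ S' hS'
      by_cases hSS : S' = S
      · subst hSS
        rcases hmem T₁ hS'.2.2.1 with rfl | rfl <;> rcases hmem T₂ hS'.2.2.2 with rfl | rfl
        · exact absurd rfl hS'.1
        · rw [hβT, hβT', add_neg_cancel]
        · rw [hβT, hβT', neg_add_cancel]
        · exact absurd rfl hS'.1
      · rw [hβ0 T₁ _ hSS, hβ0 T₂ _ hSS, add_zero]
    have hk := key β hβ fun T S' hN => hβ0 T S' fun h => hb (h ▸ hN.1)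
    rw [Th.sum_single_inner hd _ hS fun T S' hne => by
        rw [hβ0 T S' hne, inner_zero_left, mul_zero],
      Th.sumSides_eq_zero ΓD _ fun T S' hS' hD => by
        rw [hβ0 T S' fun h => hb (h ▸ hD.1), inner_zero_left, mul_zero],
      hβT, hβT', ← mul_add, inner_neg_left, ← sub_eq_add_neg, ← inner_sub_right, ← hc] at hk
    have ha := (Th.nondeg T.2).area_pos_of_subset hd hS.2.2.1 hS.2.1
    exact sub_eq_zero.1 (inner_self_eq_zero.1 ((mul_eq_zero.1 hk).resolve_left ha.ne'))
  · intro T S hST hD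
    set c := sideAvg S (u T) - uD S with hc
    -- A Dirichlet side lies in a single element and is not a Neumann side, so these normal traces
    -- need no compensation elsewhere.
    let β : Th.elements → Finset (Vec d) → Vec l := fun _ S' => if S' = S then c else 0
    have hβT : β T S = c := by simp [β]
    have hβ0 : ∀ T S', S' ≠ S → β T S' = 0 := fun T S' hne => by simp [β, hne]
    have hβ : ∀ T T' S, Th.IsInnerSide T T' S → β T S + β T' S = 0 := by
      intro T₁ T₂ S' hS'
      have hne : S' ≠ S := by
        rintro rfl
        exact Th.not_isBoundarySide_of_isInnerSide hΩ hd hS' hD.1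
      rw [hβ0 T₁ _ hne, add_zero]
    have hk := key β hβ fun T S' hN => hβ0 T S' fun h =>
      Th.not_isSideOn_both hΓ hd hD (h ▸ hN)
    have hz : ∀ (b : Th.elements → Finset (Vec d) → Vec l) (T : Th.elements) (S' : Finset (Vec d)),
        S' ≠ S → area S' * inner ℝ (β T S') (b T S') = 0 := fun b T S' hne => by
      rw [hβ0 T S' hne, inner_zero_left, mul_zero]
    rw [Th.sum_single_boundary hΩ hd _ hD.1 hST (hz fun T S => sideAvg S (u T)),
      Th.sumSides_single hΩ hd _ hD hST (hz fun _ S => uD S),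
      hβT, ← sub_eq_zero, ← mul_sub, ← inner_sub_right, ← hc] at hk
    have ha := (Th.nondeg T.2).area_pos_of_subset hd hST hD.1.1
    exact sub_eq_zero.1 (inner_self_eq_zero.1 ((mul_eq_zero.1 hk).resolve_left ha.ne'))

/-! ### The reconstructed fields -/

/-- The component of `x - x₀` along the normal is constant on a side, because `λ_p` vanishes there
for the opposite vertex `p`. -/
theorem normalConst_rtField (hd : 0 < d) (A : Th.elements → Mat l d) (b : Th.elements → Vec l)
    (x₀ : Th.elements → Vec d) : Th.NormalConst fun T => rtField (A T) (b T) (x₀ T) := by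
  classical
  intro T S hS x hx x' hx'
  obtain ⟨h1, h2⟩ := Finset.mem_powersetCard.1 hS
  obtain ⟨p, hp, -, rfl⟩ := exists_eq_erase (Th.card_eq T.1 T.2) h1 h2
  have nT := Th.nondeg T.2
  have e : inner ℝ (outerNormal T.1 (T.1.erase p)) (x - x₀ T)
      = inner ℝ (outerNormal T.1 (T.1.erase p)) (x' - x₀ T) := by
    rw [nT.inner_outerNormal hd hp, nT.inner_outerNormal hd hp, affine_sub, affine_sub,
      ((nT.mem_simplex_erase hp).1 hx).2, ((nT.mem_simplex_erase hp).1 hx').2]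
  simp only [rtField_apply, matVec_add, matVec_outer, e]

theorem elemAvg_rtField (T : Th.elements) (A : Mat l d) (b : Vec l) :
    elemAvg T.1 (rtField A b (elemAvg T.1 id)) = A := by
  rw [(Th.nondeg T.2).elemAvg_eq_apply, rtField_apply, sub_self]
  have : outer ((d : ℝ)⁻¹ • b) (0 : Vec d) = 0 := (outerLin ((d : ℝ)⁻¹ • b)).map_zero
  rw [this, add_zero]

theorem elemAvg_crField (T : Th.elements) (A : Mat l d) (b : Vec l) :
    elemAvg T.1 (crField A b (elemAvg T.1 id)) = b := by
  rw [(Th.nondeg T.2).elemAvg_eq_apply, crField_apply, sub_self]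
  have : matVec A 0 = 0 := (matVecLin A).map_zero
  rw [this, add_zero]

/-- The mean and divergence of the reconstruction are the two gradients. Integration by parts on the
elements therefore turns the Euler--Lagrange equations into the weak form of admissibility, and the
gradients give equality in Fenchel--Young. -/
theorem marini_dual (hd : 0 < d) (hΩ : interior (closure Ω) = Ω)
    (hΓ : Th.IsBoundaryPartition ΓD ΓN) (hφ : Th.IsIntegrand φ) (hψ : Th.IsIntegrand ψ)
    (hC : ∀ᵐ x ∂(volume.restrict Ω), IsC1 (φ x) ∧ IsC1 (ψ x))
    {u : Th.Broken (Vec l)} (hu : u ∈ Th.CR l)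
    (hmin : IsMinOn (Th.primal ΓD ΓN φ ψ gN uD) (Th.CR l) u) :
    ∃ z ∈ Th.RT l,
      (∀ T : Th.elements, ∀ᵐ x ∂(volume.restrict (simplex T.1)),
        z T x = D (φ x) (grad (u T))
          + outer ((d : ℝ)⁻¹ • D (ψ x) (elemAvg T.1 (u T))) (x - elemAvg T.1 id)) ∧
      IsMaxOn (Th.dual ΓD ΓN φ ψ gN uD) (Th.RT l) z ∧
      Th.primal ΓD ΓN φ ψ gN uD u = Th.dual ΓD ΓN φ ψ gN uD z := by
  obtain ⟨φT, rφ, pφ⟩ := hφ.exists_isRep hΩ (P := IsC1) (by filter_upwards [hC] with x hx using hx.1)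
  obtain ⟨ψT, rψ, pψ⟩ := hψ.exists_isRep hΩ (P := IsC1) (by filter_upwards [hC] with x hx using hx.2)
  choose gφ hgφ hDφ using fun T => (pφ T).2.2.2.exists_hasGradientAt
  choose gψ hgψ hDψ using fun T => (pψ T).2.2.2.exists_hasGradientAt
  -- A competitor with the Dirichlet side means has finite energy, so the minimiser has energy below
  -- `⊤` and satisfies the Dirichlet condition.
  obtain ⟨v, hv, hvα⟩ := Th.exists_CR hd uD
  have hfin : Th.primal ΓD ΓN φ ψ gN uD u ≠ ⊤ := by
    have h1 := primal_eq (ΓD := ΓD) (ΓN := ΓN) (gN := gN) (uD := uD) rφ rψ (v := v)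
      (fun T => hgφ T _) (fun T => hgψ T _) fun T S hS hD => hvα T S hS hD.1.1
    have h2 : Th.primal ΓD ΓN φ ψ gN uD u ≤ Th.primal ΓD ΓN φ ψ gN uD v := hmin hv
    rw [h1] at h2
    exact (h2.trans_lt (EReal.coe_lt_top _)).ne
  obtain ⟨huD, -⟩ := exists_of_primal_ne_top rφ rψ (fun T => (pφ T).1) (fun T => (pψ T).1) hfin
  let z : Th.Broken (Mat l d) := fun T => rtField (D (φT T) (grad (u T)))
    (D (ψT T) (elemAvg T.1 (u T))) (elemAvg T.1 id)
  have hz : Th.NormalConst z := normalConst_rtField hd _ _ _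
  have zavg : ∀ T, elemAvg T.1 (z T) = D (φT T) (grad (u T)) := fun T => elemAvg_rtField T _ _
  have zdiv : ∀ T, div (z T) = D (ψT T) (elemAvg T.1 (u T)) := fun T => div_rtField hd _ _ _
  obtain ⟨hzRT, hzN⟩ := mem_RT_of_weak (gN := gN) hΩ hd hΓ hz fun w hw hwD => by
    rw [hz.gauss hd]
    simp only [zavg, zdiv]
    exact primal_eulerLagrange hd rφ rψ hgφ hgψ (fun T => hDφ T _) (fun T => hDψ T _) hu huD hmin
      hw hwD
  have heq : Th.primal ΓD ΓN φ ψ gN uD u = Th.dual ΓD ΓN φ ψ gN uD z := by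
    refine strong_duality hΩ hd hΓ rφ rψ hu huD hzRT hzN
      (a' := fun T => inner ℝ (elemAvg T.1 (z T)) (grad (u T)) - gφ T (grad (u T)))
      (b' := fun T => inner ℝ (div (z T)) (elemAvg T.1 (u T)) - gψ T (elemAvg T.1 (u T)))
      (fun T => hgφ T _) (fun T => hgψ T _)
      (fun T => ?_) (fun T => ?_) (fun T => ?_) fun T => ?_
    · rw [zavg]; exact conj_gradient (pφ T).2.1 (hgφ T) (hDφ T _)
    · rw [zdiv]; exact conj_gradient (pψ T).2.1 (hgψ T) (hDψ T _)
    · ring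
    · ring
  refine ⟨z, hzRT, fun T => ?_, fun y hy => ?_, heq⟩
  · filter_upwards [rφ T, rψ T] with x hx hx'
    rw [hx, hx', ← rtField_apply]
  · rw [Set.mem_ofPred_eq, ← heq]
    exact weak_duality hΩ hd hΓ rφ rψ (fun T => (pφ T).1) (fun T => (pψ T).1) hu hy

/-- The mirror image: the gradient and mean of the reconstruction are the gradients of the
conjugates. Equality in Fenchel--Young now has to be read back on `φ` and `ψ`, which is where their
lower semicontinuity and convexity enter. -/
theorem marini_primal (hd : 0 < d) (hΩ : interior (closure Ω) = Ω)
    (hΓ : Th.IsBoundaryPartition ΓD ΓN) (hφ : Th.IsIntegrand φ) (hψ : Th.IsIntegrand ψ)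
    (hC : ∀ᵐ x ∂(volume.restrict Ω), IsC1 (conj (φ x)) ∧ IsC1 (conj (ψ x)))
    {z : Th.Broken (Mat l d)} (hz : z ∈ Th.RT l)
    (hmax : IsMaxOn (Th.dual ΓD ΓN φ ψ gN uD) (Th.RT l) z) :
    ∃ u ∈ Th.CR l,
      (∀ T : Th.elements, ∀ᵐ x ∂(volume.restrict (simplex T.1)),
        u T x = D (conj (ψ x)) (div (z T))
          + matVec (D (conj (φ x)) (elemAvg T.1 (z T))) (x - elemAvg T.1 id)) ∧
      IsMinOn (Th.primal ΓD ΓN φ ψ gN uD) (Th.CR l) u ∧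
      Th.primal ΓD ΓN φ ψ gN uD u = Th.dual ΓD ΓN φ ψ gN uD z := by
  classical
  obtain ⟨φT, rφ, pφ⟩ := hφ.exists_isRep hΩ (P := fun f => IsC1 (conj f))
    (by filter_upwards [hC] with x hx using hx.1)
  obtain ⟨ψT, rψ, pψ⟩ := hψ.exists_isRep hΩ (P := fun f => IsC1 (conj f))
    (by filter_upwards [hC] with x hx using hx.2)
  choose gφ hgφ hDφ using fun T => (pφ T).2.2.2.exists_hasGradientAt
  choose gψ hgψ hDψ using fun T => (pψ T).2.2.2.exists_hasGradientAt
  have hzc := ((mem_RT_iff hd).1 hz).1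
  -- A competitor with the Neumann data as normal trace has a finite dual value, so the maximiser
  -- satisfies the Neumann condition.
  obtain ⟨y, hy, hyβ⟩ := Th.exists_RT hd
    (fun _ S => if Th.IsSideOn ΓN S then gN S else 0) fun T T' S hS => by
      have := Th.not_isBoundarySide_of_isInnerSide hΩ hd hS
      rw [if_neg fun h => this h.1, add_zero]
  have hfin : Th.dual ΓD ΓN φ ψ gN uD z ≠ ⊥ := by
    have h1 := dual_eq (ΓD := ΓD) (ΓN := ΓN) (gN := gN) (uD := uD) hd rφ rψ
      ((mem_RT_iff hd).1 hy).1 (fun T => hgφ T _) (fun T => hgψ T _) fun T S hS hN => by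
        rw [hyβ T S hS hN.1.1, if_pos hN]
    have h2 : Th.dual ΓD ΓN φ ψ gN uD y ≤ Th.dual ΓD ΓN φ ψ gN uD z := hmax hy
    rw [h1] at h2
    exact ((EReal.bot_lt_coe _).trans_le h2).ne'
  obtain ⟨hzN, -⟩ := exists_of_dual_ne_bot hd rφ rψ (fun T => (pφ T).1) (fun T => (pψ T).1) hzc hfin
  let u : Th.Broken (Vec l) := fun T => crField (D (conj (φT T)) (elemAvg T.1 (z T)))
    (D (conj (ψT T)) (div (z T))) (elemAvg T.1 id)
  have uavg : ∀ T, elemAvg T.1 (u T) = D (conj (ψT T)) (div (z T)) := fun T => elemAvg_crField T _ _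
  have ugrad : ∀ T, grad (u T) = D (conj (φT T)) (elemAvg T.1 (z T)) := fun T => grad_crField _ _ _
  obtain ⟨huCR, huD⟩ := mem_CR_of_weak (uD := uD) hΩ hd hΓ (u := u) fun w hw hwN => by
    rw [((mem_RT_iff hd).1 hw).1.gauss hd]
    simp only [uavg, ugrad, real_inner_comm (D _ _)]
    exact dual_eulerLagrange hd rφ rψ hgφ hgψ (fun T => hDφ T _) (fun T => hDψ T _) hz hzN hmax
      hw hwN
  have heq : Th.primal ΓD ΓN φ ψ gN uD u = Th.dual ΓD ΓN φ ψ gN uD z := by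
    refine strong_duality hΩ hd hΓ rφ rψ huCR huD hz hzN
      (a := fun T => inner ℝ (elemAvg T.1 (z T)) (grad (u T)) - gφ T (elemAvg T.1 (z T)))
      (b := fun T => inner ℝ (div (z T)) (elemAvg T.1 (u T)) - gψ T (div (z T)))
      (fun T => ?_) (fun T => ?_)
      (fun T => hgφ T _) (fun T => hgψ T _) (fun T => ?_) fun T => ?_
    · rw [ugrad]
      exact apply_gradient_conj (pφ T).1 (pφ T).2.1 (pφ T).2.2.1 (hgφ T) (hDφ T _)
    · rw [uavg]
      exact apply_gradient_conj (pψ T).1 (pψ T).2.1 (pψ T).2.2.1 (hgψ T) (hDψ T _)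
    · ring
    · ring
  refine ⟨u, huCR, fun T => ?_, fun v hv => ?_, heq⟩
  · filter_upwards [rφ T, rψ T] with x hx hx'
    rw [hx, hx', ← crField_apply]
  · rw [Set.mem_ofPred_eq, heq]
    exact weak_duality hΩ hd hΓ rφ rψ (fun T => (pφ T).1) (fun T => (pψ T).1) hv hz

end Triangulation

end DiscreteDuality

end

open DiscreteDuality DiscreteDuality.Triangulation in
theorem proposition3p6 {d l : ℕ} (hd : 0 < d) (Ω : Set (Vec d))
    (hΩ : interior (closure Ω) = Ω) (Th : Triangulation Ω)
    (ΓD ΓN : Set (Vec d)) (hΓ : Th.IsBoundaryPartition ΓD ΓN)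
    (φ : Vec d → Mat l d → EReal) (hφ : Th.IsIntegrand φ)
    (ψ : Vec d → Vec l → EReal) (hψ : Th.IsIntegrand ψ)
    (gN uD : Finset (Vec d) → Vec l) :
    -- (i) from a discrete primal solution to a discrete dual solution
    ((∀ᵐ x ∂(volume.restrict Ω), IsC1 (φ x) ∧ IsC1 (ψ x)) →
      ∀ u ∈ Th.CR l, IsMinOn (Th.primal ΓD ΓN φ ψ gN uD) (Th.CR l) u →
        ∃ z ∈ Th.RT l,
          (∀ T : Th.elements, ∀ᵐ x ∂(volume.restrict (simplex T.1)),
            z T x = D (φ x) (grad (u T))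
              + outer ((d : ℝ)⁻¹ • D (ψ x) (elemAvg T.1 (u T))) (x - elemAvg T.1 id)) ∧
          IsMaxOn (Th.dual ΓD ΓN φ ψ gN uD) (Th.RT l) z ∧
          Th.primal ΓD ΓN φ ψ gN uD u = Th.dual ΓD ΓN φ ψ gN uD z) ∧
    -- (ii) from a discrete dual solution to a discrete primal solution
    ((∀ᵐ x ∂(volume.restrict Ω), IsC1 (conj (φ x)) ∧ IsC1 (conj (ψ x))) →
      ∀ z ∈ Th.RT l, IsMaxOn (Th.dual ΓD ΓN φ ψ gN uD) (Th.RT l) z →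
        ∃ u ∈ Th.CR l,
          (∀ T : Th.elements, ∀ᵐ x ∂(volume.restrict (simplex T.1)),
            u T x = D (conj (ψ x)) (div (z T))
              + matVec (D (conj (φ x)) (elemAvg T.1 (z T))) (x - elemAvg T.1 id)) ∧
          IsMinOn (Th.primal ΓD ΓN φ ψ gN uD) (Th.CR l) u ∧
          Th.primal ΓD ΓN φ ψ gN uD u = Th.dual ΓD ΓN φ ψ gN uD z) :=
  ⟨fun hC _ hu hmin => marini_dual hd hΩ hΓ hφ hψ hC hu hmin,
    fun hC _ hz hmax => marini_primal hd hΩ hΓ hφ hψ hC hz hmax⟩
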